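/- **Theorem.** Let $d,n\ge 1$ and consider $\min_{x\in\mathbb R^d}F(x)=f(x)+\psi(x)$, $f=\frac1n\sum_{i=1}^n f_i$, where $\psi:\mathbb R^d\to\mathbb R$ is convex and each $f_i:\mathbb R^d\to\mathbb R$ is differentiable (not necessarily convex) with $\|\nabla f_i(x)-\nabla f_i(y)\|\le L\|x-y\|$ and $\|\nabla f_i(x)\|^2\le\sigma^2$ for all $x,y$, with $L>0$. Let $x_*$ be a global minimizer of $F$. For $\eta>0$ put $\mathrm{Prox}_{\eta\psi}(x)=\arg\min_y\{\psi(y)+\frac1{2\eta}\|y-x\|^2\}$ and $g_\eta(x)=\frac1\eta\big(x-\mathrm{Prox}_{\eta\psi}(x-\eta\nabla f(x))\big)$. For $\mu>0$ and a direction $u$, the Gaussian smoothing estimate of $\nabla f_i(x)$ is $\hat\nabla f_i(x)=\frac{f_i(x+\mu u)-f_i(x)}{\mu}u$, $u\sim\mathcal N(0,I)$. ZO-ProxSVRG with this estimator, for integers $b,m,S\ge1$ and $T=mS$: start from a (possibly random) $x_0^1=\tilde x^1$ with $F(x^1_0)$ integrable. In epoch $s=1,\dots,S$ draw directions $u_1,\dots,u_n$,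 form $\hat\nabla f_i(\tilde x^s)$ for all $i$ and $\hat\nabla f(\tilde x^s)=\frac1n\sum_i\hat\nabla f_i(\tilde x^s)$, and set $x_0^s=\tilde x^s$. For $t=0,\dots,m-1$ draw a uniformly random mini-batch $\mathcal I_t$ of $b$ indices from $\{1,\dots,n\}$ and fresh directions (one for each index) for the estimates $\hat\nabla f_i(x_t^s)$, and set $\hat v_t^s=\frac1b\sum_{i\in\mathcal I_t}\big(\hat\nabla f_i(x_t^s)-\hat\nabla f_i(\tilde x^s)\big)+\hat\nabla f(\tilde x^s)$ and $x_{t+1}^s=\mathrm{Prox}_{\eta\psi}(x_t^s-\eta\hat v_t^s)$. Then $\tilde x^{s+1}=x_0^{s+1}=x_m^s$. All directions are i.i.d. $\mathcal N(0,I)$, all mini-batches are i.i.d., and directions, mini-batches and starting point are independent. Mini-batches are drawn either with replacement, and then $\delta_n=1$, or without replacement (with $b\le n$), and then $\delta_n=1$ if $b<n$ and $\delta_n=0$ if $b=n$. (i) Let $0<\rho<\frac12$, $\eta=\rho/L$, $\gamma=\frac\eta2-\eta^2L$ and $\frac{24\rho^2m^2}{b}+\rho\le1$. Then all expectations below are finite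 and $$\frac1T\sum_{s=1}^S\sum_{t=1}^m\mathbb E\|g_\eta(x_t^s)\|^2\le\frac{\mathbb E[F(x_0^1)-F(x_*)]}{T\gamma}+\Big(1+\frac{6\delta_n}{b}\Big)(d+6)^3\frac{L^2\mu^2\eta}{\gamma}+\Big(2+\frac{12\delta_n}{b}\Big)(2d+9)\frac{\sigma^2\eta}{\gamma}.$$ (ii) There is an absolute constant $K_2$ and, for all $L,C>0$, a constant $K_1$ depending only on $L$ and $C$, such that if $b=\lfloor n^{2/3}\rfloor$, $m=\lfloor n^{1/3}\rfloor$, $\rho=\frac16$, $\eta=\rho/L$ and $0<\mu\le\frac{C}{d\sqrt T}$, then $$\frac1T\sum_{s=1}^S\sum_{t=1}^m\mathbb E\|g_\eta(x_t^s)\|^2\le\frac{18L\,\mathbb E[F(x_0^1)-F(x_*)]}{T}+K_1\frac dT+K_2\,d\sigma^2 .$$ -/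

import Mathlib

open MeasureTheory ProbabilityTheory

universe u

noncomputable section

namespace ZOProxSVRG

/-- The decision space `ℝ^d` with the `ℓ₂` norm. -/
abbrev E (d : ℕ) : Type := EuclideanSpace ℝ (Fin d)

/-- The data of the composite finite-sum problem
`min_x F(x) = f(x) + ψ(x)`, `f = (1/n) ∑ i, f_i`. -/
structure Problem (d n : ℕ) where
  /-- the components `f_i` of the loss -/
  comp : Fin n → E d → ℝ
  /-- the regularizer `ψ` -/
  reg : E d → ℝ

namespace Problem

variable {d n : ℕ}

/-- `f = (1/n) ∑ i, f_i`. -/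
def loss (p : Problem d n) (x : E d) : ℝ := (1 / (n : ℝ)) * ∑ i, p.comp i x

/-- `F = f + ψ`. -/
def obj (p : Problem d n) (x : E d) : ℝ := p.loss x + p.reg x

/-- Standing assumptions: every `f_i` is differentiable with `L`-Lipschitz gradient, all gradients
satisfy `‖∇ f_i(x)‖² ≤ σ²`, and `ψ` is convex. -/
structure Regular (p : Problem d n) (L σ : ℝ) : Prop where
  differentiable : ∀ i, Differentiable ℝ (p.comp i)
  lipschitz : ∀ i x y, ‖gradient (p.comp i) x - gradient (p.comp i) y‖ ≤ L * ‖x - y‖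
  bounded : ∀ i x, ‖gradient (p.comp i) x‖ ^ 2 ≤ σ ^ 2
  convex : ConvexOn ℝ Set.univ p.reg

/-- `x` is an optimal solution, i.e. a global minimizer of `F`. -/
def IsOptimal (p : Problem d n) (x : E d) : Prop := ∀ y, p.obj x ≤ p.obj y

end Problem

variable {d n b : ℕ}

/-- The proximal operator `Prox_{ηψ}(x) = argmin_y { ψ(y) + ‖y - x‖² / (2η) }`
(for convex `ψ : ℝ^d → ℝ` and `η > 0` the minimizer exists and is unique). -/
def prox (η : ℝ) (ψ : E d → ℝ) (x : E d) : E d :=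
  Classical.epsilon fun y : E d =>
    ∀ z : E d, ψ y + 1 / (2 * η) * ‖y - x‖ ^ 2 ≤ ψ z + 1 / (2 * η) * ‖z - x‖ ^ 2

/-- The gradient mapping `g_η(x) = (1/η) (x - Prox_{ηψ}(x - η ∇f(x)))`. -/
def gradMap (p : Problem d n) (η : ℝ) (x : E d) : E d :=
  (1 / η) • (x - prox η p.reg (x - η • gradient p.loss x))

/-- The Gaussian smoothing gradient estimate of `h` at `x` with smoothing parameter `μ`
in direction `u`: `((h(x + μu) - h(x)) / μ) u`. -/
def gauSGE (μ : ℝ) (h : E d → ℝ) (x u : E d) : E d := ((h (x + μ • u) - h x) / μ) • u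

/-- One realization of all the randomness used by the algorithm; epochs `s` and inner steps `t` are
counted from `0`.  For each `s`, `dir s 0 i` is the direction used for `f_i` at the
snapshot of epoch `s`, and `dir s (t + 1) i` is the direction used for `f_i` at the inner iterate
number `t` of epoch `s`.  The mini-batch of step `t` in epoch `s` is listed as a tuple `batch s t`
of `b` indices. -/
structure Tape (d n b : ℕ) where
  /-- the starting point -/
  init : E d
  /-- the smoothing directions -/
  dir : ℕ → ℕ → Fin n → E d
  /-- the mini-batches -/
  batch : ℕ → ℕ → Fin b → Fin n

/-- The mini-batch estimate `∇̂f_I(x) = (1/b) ∑_{i ∈ I} ∇̂f_i(x)`, with direction `u i` for `f_i`. -/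
def batchEstimate (p : Problem d n) (μ : ℝ) (I : Fin b → Fin n) (u : Fin n → E d) (x : E d) : E d :=
  (1 / (b : ℝ)) • ∑ k, gauSGE μ (p.comp (I k)) x (u (I k))

/-- The full estimate `∇̂f(x) = (1/n) ∑ i, ∇̂f_i(x)`, with direction `u i` for `f_i`. -/
def fullEstimate (p : Problem d n) (μ : ℝ) (u : Fin n → E d) (x : E d) : E d :=
  (1 / (n : ℝ)) • ∑ i, gauSGE μ (p.comp i) x (u i)

/-- The mixture gradient `v̂ = ∇̂f_I(x) - ∇̂f_I(x̃) + ∇̂f(x̃)`.  The estimates `∇̂f_i(x̃)` at the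
snapshot `x̃` use the directions `w` drawn at the start of the epoch, in the last two terms alike;
those at `x` use the directions `u` drawn at this step. -/
def mixture (p : Problem d n) (μ : ℝ) (xs : E d) (w : Fin n → E d) (I : Fin b → Fin n)
    (u : Fin n → E d) (x : E d) : E d :=
  batchEstimate p μ I u x - batchEstimate p μ I w xs + fullEstimate p μ w xs

/-- The iterates `x_0 = x̃, x_1, x_2, …` of epoch `s` started at the snapshot `x̃ = xs`:
`x_{t+1} = Prox_{ηψ}(x_t - η v̂_t)`. -/
def inner (p : Problem d n) (η μ : ℝ) (τ : Tape d n b) (s : ℕ) (xs : E d) : ℕ → E d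
  | 0 => xs
  | t + 1 =>
    prox η p.reg (inner p η μ τ s xs t -
      η • mixture p μ xs (τ.dir s 0) (τ.batch s t) (τ.dir s (t + 1)) (inner p η μ τ s xs t))

/-- The snapshots: the first one is the starting point, the next one is the last of the `m` iterates
of the epoch. -/
def snapshot (p : Problem d n) (η μ : ℝ) (m : ℕ) (τ : Tape d n b) : ℕ → E d
  | 0 => τ.init
  | s + 1 => inner p η μ τ s (snapshot p η μ m τ s) m

/-- The iterate `x_t^{s+1}` of the algorithm (epochs are counted from `0` here). -/
def iterate (p : Problem d n) (η μ : ℝ) (m : ℕ) (τ : Tape d n b) (s t : ℕ) : E d :=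
  inner p η μ τ s (snapshot p η μ m τ s) t

/-- The two ways of drawing a mini-batch. -/
inductive Sampling
  | withReplacement
  | withoutReplacement

/-- The tuples of `b` indices that can be drawn: all of them with replacement, those with distinct
entries without. -/
def Sampling.batches (n b : ℕ) : Sampling → Set (Fin b → Fin n)
  | .withReplacement => Set.univ
  | .withoutReplacement => {I | Function.Injective I}

/-- `δ_n`: it is `1` with replacement; without replacement it is `1` if `b < n` and `0` otherwise. -/
def Sampling.delta (n b : ℕ) : Sampling → ℝ
  | .withReplacement => 1
  | .withoutReplacement => if b < n then 1 else 0

/-- The joint law of the randomness: the smoothing directions are i.i.d. `N(0, I)`, the mini-batches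
are i.i.d. uniform, and starting point, directions and mini-batches are independent of each other. -/
structure IsDraw {Ω : Type u} [MeasurableSpace Ω] (r : Sampling) (P : Measure Ω)
    (τ : Ω → Tape d n b) : Prop where
  measurable_init : Measurable fun ω => (τ ω).init
  measurable_dir : ∀ s k i, Measurable fun ω => (τ ω).dir s k i
  measurable_batch : ∀ s t, Measurable fun ω => (τ ω).batch s t
  law_dir : ∀ s k i, HasLaw (fun ω => (τ ω).dir s k i) (stdGaussian (E d)) P
  law_batch : ∀ s t, HasLaw (fun ω => (τ ω).batch s t) (uniformOn (r.batches n b)) P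
  indep_dir : iIndepFun (fun (q : ℕ × ℕ × Fin n) ω => (τ ω).dir q.1 q.2.1 q.2.2) P
  indep_batch : iIndepFun (fun (q : ℕ × ℕ) ω => (τ ω).batch q.1 q.2) P
  indep_init_dir : IndepFun (fun ω => (τ ω).init) (fun ω => (τ ω).dir) P
  indep_batches : IndepFun (fun ω => ((τ ω).init, (τ ω).dir)) (fun ω => (τ ω).batch) P

/-- `𝔼 ‖g_η(x)‖²` for the output `x` of the algorithm, an iterate chosen uniformly at random among
the `T = m S` iterates `x_t^s`, `1 ≤ t ≤ m`, `1 ≤ s ≤ S`. -/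
def avgSqGradMap {Ω : Type u} [MeasurableSpace Ω] (P : Measure Ω) (p : Problem d n) (η μ : ℝ)
    (m S : ℕ) (τ : Ω → Tape d n b) : ℝ :=
  (1 / ((m * S : ℕ) : ℝ)) * ∑ s ∈ Finset.range S, ∑ t ∈ Finset.Icc 1 m,
    ∫ ω, ‖gradMap p η (iterate p η μ m (τ ω) s t)‖ ^ 2 ∂P

end ZOProxSVRG

end

/-! Write γ = η/2 - η²L. An iteration is a proximal gradient step with an inexact gradient v̂, and
two comparisons of objective values give, for each realization, F(x⁺) + γ‖g_η(x)‖² ≤ F(x) + (η/2)‖v̂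
- ∇f(x)‖² (`obj_prox_add_sq_gradMap_le`). Since all ∇f_i are bounded, the expected error is at most
one constant at every step, however far x is from the snapshot. Hence F itself serves as the
potential, and the inequality telescopes in expectation.

For the constant (`mixture_error`), split v̂ - ∇f(x) into the centred mini-batch mean of ζ_i =
∇̂f_i(x) - ∇̂f_i(x̃) and the average over all i of ∇̂f_i(x) - ∇f_i(x). Different draws of a
mini-batch are uncorrelated or negatively correlated, so the first part has second moment at most
δ_n/b times the average of 𝔼‖ζ_i‖². Up to a remainder of norm (Lμ/2)‖u‖³, ∇̂f_i(x) equals ⟨∇f_i(x),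
u⟩u, so everything reduces to 𝔼⟨g,u⟩²‖u‖² = (d+2)‖g‖² and 𝔼‖u‖⁶ = d(d+2)(d+4). Independence enters
only between a point and one direction, and between a mini-batch and the data it averages.

Descent controls g_η at x_0, …, x_{m-1} of each epoch, whereas the claim concerns x_1, …, x_m. As
epochs are glued end to end, only the very last point is new; one exact proximal step bounds its
gradient mapping by F - F(x_*) (`sq_gradMap_le`, `sum_epochs_le`). The second claim is the first
with γ = 1/(18L). -/

namespace ZOProxSVRG

/-! ### Smoothness and minimizers of convex plus quadratic functions -/

section Analysis

variable {V : Type*} [NormedAddCommGroup V] [InnerProductSpace ℝ V]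

/-- Along the segment x + tv the remainder has derivative at most L‖v‖²t in absolute value, so
(L/2)‖v‖²t² dominates it. Both signs are needed: `obj_prox_le` bounds f from above at one point and
from below at another. -/
theorem abs_sub_sub_inner_gradient_le [CompleteSpace V] {h : V → ℝ} {L : ℝ}
    (hd : Differentiable ℝ h) (hL : ∀ x y, ‖gradient h x - gradient h y‖ ≤ L * ‖x - y‖) (x y : V) :
    |h y - h x - Inner.inner ℝ (gradient h x) (y - x)| ≤ L / 2 * ‖y - x‖ ^ 2 := by
  set v := y - x
  have hderiv : ∀ t : ℝ, HasDerivAt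
      (fun t : ℝ => h (x + t • v) - h x - t * Inner.inner ℝ (gradient h x) v)
      (Inner.inner ℝ (gradient h (x + t • v) - gradient h x) v) t := by
    intro t
    have h1 : HasDerivAt (fun t : ℝ => x + t • v) v t := by
      simpa using ((hasDerivAt_id t).smul_const v).const_add x
    have h2 := (hd (x + t • v)).hasGradientAt.hasFDerivAt.comp_hasDerivAt t h1
    have h3 := (h2.sub_const (h x)).sub ((hasDerivAt_id t).mul_const (Inner.inner ℝ (gradient h x) v))
    refine h3.congr_deriv ?_
    simp [inner_sub_left]
  have key := image_norm_le_of_norm_deriv_right_le_deriv_boundary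
    (f := fun t : ℝ => h (x + t • v) - h x - t * Inner.inner ℝ (gradient h x) v)
    (B := fun t => L / 2 * ‖v‖ ^ 2 * t ^ 2) (B' := fun t => L * ‖v‖ ^ 2 * t) (a := 0) (b := 1)
    (fun t _ => (hderiv t).continuousAt.continuousWithinAt)
    (fun t _ => (hderiv t).hasDerivWithinAt) (by simp)
    (fun t => by
      have := ((hasDerivAt_id t).pow 2).const_mul (L / 2 * ‖v‖ ^ 2)
      refine this.congr_deriv ?_
      simp; ring)
    (fun t ht => by
      rw [Real.norm_eq_abs]
      refine (abs_real_inner_le_norm _ _).trans ?_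
      have := hL (x + t • v) x
      rw [add_sub_cancel_left, norm_smul, Real.norm_of_nonneg ht.1] at this
      nlinarith [norm_nonneg v])
    (Set.right_mem_Icc.2 zero_le_one)
  simpa [v] using key

/-- A convex function bounded below on the unit ball around x can fall at most linearly along rays,
so the quadratic term makes the sum coercive. -/
theorem exists_isMinOn_add_sq [FiniteDimensional ℝ V] {ψ : V → ℝ} (hψ : ConvexOn ℝ Set.univ ψ)
    {c : ℝ} (hc : 0 < c) (x : V) :
    ∃ y, ∀ z, ψ y + c * ‖y - x‖ ^ 2 ≤ ψ z + c * ‖z - x‖ ^ 2 := by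
  have hcont : Continuous ψ := continuousOn_univ.1 (hψ.continuousOn isOpen_univ)
  obtain ⟨M, hM⟩ := (isCompact_closedBall x 1).bddBelow_image hcont.continuousOn
  have hM' : ∀ z, ‖z - x‖ ≤ 1 → M ≤ ψ z := fun z hz =>
    hM ⟨z, by simpa [dist_eq_norm] using hz, rfl⟩
  have hlow : ∀ z, 1 ≤ ‖z - x‖ → ψ x - ‖z - x‖ * (ψ x - M) ≤ ψ z := by
    intro z hz
    have hr : 0 < ‖z - x‖ := by linarith
    -- These weights give the point of the segment from x to z at distance one from x, where the
    -- bound M is available.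
    have h1 := hψ.2 (Set.mem_univ x) (Set.mem_univ z)
      (sub_nonneg.2 (inv_le_one_of_one_le₀ hz)) (inv_nonneg.2 hr.le) (sub_add_cancel _ _)
    have h2 : M ≤ ψ ((1 - ‖z - x‖⁻¹) • x + ‖z - x‖⁻¹ • z) := by
      apply hM'
      have : (1 - ‖z - x‖⁻¹) • x + ‖z - x‖⁻¹ • z - x = ‖z - x‖⁻¹ • (z - x) := by module
      rw [this, norm_smul, norm_inv, norm_norm, inv_mul_cancel₀ hr.ne']
    have h3 := h2.trans h1
    simp only [smul_eq_mul] at h3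
    have h4 := mul_le_mul_of_nonneg_left h3 hr.le
    have h5 : ‖z - x‖ * ((1 - ‖z - x‖⁻¹) * ψ x + ‖z - x‖⁻¹ * ψ z) = (‖z - x‖ - 1) * ψ x + ψ z := by
      field_simp
    rw [h5] at h4
    linarith
  refine Continuous.exists_forall_le' (by fun_prop) x ?_
  have htend := tendsto_dist_right_cocompact_atTop x
  have hMx : M ≤ ψ x := hM' x (by simp)
  filter_upwards [htend.eventually_ge_atTop (1 + (ψ x - M) / c)] with z hz
  rw [dist_eq_norm] at hz
  have h0 : 0 ≤ (ψ x - M) / c := div_nonneg (by linarith) hc.le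
  have h1 : 1 ≤ ‖z - x‖ := by linarith
  have h2 := hlow z h1
  have h3 : ψ x - M ≤ c * ‖z - x‖ := by
    have : c * (1 + (ψ x - M) / c) ≤ c * ‖z - x‖ := mul_le_mul_of_nonneg_left hz hc.le
    have e : c * (1 + (ψ x - M) / c) = c + (ψ x - M) := by field_simp
    linarith
  simp only [sub_self, norm_zero]
  nlinarith

/-- Compare the minimizer y with (1 - l)y + lz, divide by l and let l tend to 0. This optimality
condition replaces subgradients. -/
theorem inner_le_of_isMinOn_add_sq {ψ : V → ℝ} (hψ : ConvexOn ℝ Set.univ ψ) {c : ℝ} {x y : V}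
    (hy : ∀ z, ψ y + c * ‖y - x‖ ^ 2 ≤ ψ z + c * ‖z - x‖ ^ 2) (z : V) :
    ψ y + 2 * c * Inner.inner ℝ (x - y) (z - y) ≤ ψ z := by
  have key : ∀ l : ℝ, 0 < l → l ≤ 1 →
      ψ y + 2 * c * Inner.inner ℝ (x - y) (z - y) - ψ z ≤ c * ‖z - y‖ ^ 2 * l := by
    intro l hl hl1
    have h1 := hψ.2 (Set.mem_univ y) (Set.mem_univ z) (sub_nonneg.2 hl1) hl.le
      (sub_add_cancel _ _)
    have h2 := hy ((1 - l) • y + l • z)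
    have e : (1 - l) • y + l • z - x = l • (z - y) - (x - y) := by module
    rw [e, norm_sub_sq_real (l • (z - y)), norm_smul, inner_smul_left, Real.norm_of_nonneg hl.le,
      real_inner_comm (x - y), norm_sub_rev y x] at h2
    simp only [smul_eq_mul, conj_trivial] at h1 h2
    refine le_of_mul_le_mul_left ?_ hl
    nlinarith
  have hlim : Filter.Tendsto (fun l : ℝ => c * ‖z - y‖ ^ 2 * l) (nhdsWithin 0 (Set.Ioi 0))
      (nhds 0) := by
    have : Continuous fun l : ℝ => c * ‖z - y‖ ^ 2 * l := by fun_prop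
    simpa using (this.tendsto 0).mono_left nhdsWithin_le_nhds
  have := ge_of_tendsto hlim (by
    filter_upwards [Ioc_mem_nhdsGT (zero_lt_one' ℝ)] with l hl using key l hl.1 hl.2)
  linarith

end Analysis

/-! ### The proximal map and the one-step descent inequality -/

variable {d n b : ℕ}

theorem prox_spec {ψ : E d → ℝ} (hψ : ConvexOn ℝ Set.univ ψ) {η : ℝ} (hη : 0 < η) (x z : E d) :
    ψ (prox η ψ x) + 1 / η * Inner.inner ℝ (x - prox η ψ x) (z - prox η ψ x) ≤ ψ z := by
  have h := Classical.epsilon_spec (exists_isMinOn_add_sq hψ (c := 1 / (2 * η)) (by positivity) x)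
  have := inner_le_of_isMinOn_add_sq hψ h z
  have e : 2 * (1 / (2 * η)) = 1 / η := by field_simp
  rwa [e] at this

/-- Test the optimality condition of each proximal point at the other, add, and apply
Cauchy–Schwarz. It serves to make the iterates measurable. -/
theorem norm_prox_sub_prox_le {ψ : E d → ℝ} (hψ : ConvexOn ℝ Set.univ ψ) {η : ℝ} (hη : 0 < η)
    (x y : E d) : ‖prox η ψ x - prox η ψ y‖ ≤ ‖x - y‖ := by
  have h1 := prox_spec hψ hη x (prox η ψ y)
  have h2 := prox_spec hψ hη y (prox η ψ x)
  set p := prox η ψ x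
  set q := prox η ψ y
  have h3 : 1 / η * (Inner.inner ℝ (x - p) (q - p) + Inner.inner ℝ (y - q) (p - q)) ≤ 0 := by linarith
  have h4 : Inner.inner ℝ (x - p) (q - p) + Inner.inner ℝ (y - q) (p - q) ≤ 0 := by
    by_contra! h
    have : 0 < 1 / η := by positivity
    nlinarith
  have h5 : Inner.inner ℝ (x - p) (q - p) + Inner.inner ℝ (y - q) (p - q)
      = ‖p - q‖ ^ 2 - Inner.inner ℝ (x - y) (p - q) := by
    rw [← real_inner_self_eq_norm_sq]
    simp only [inner_sub_left, inner_sub_right]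
    ring
  have h6 := real_inner_le_norm (x - y) (p - q)
  nlinarith [norm_nonneg (p - q), norm_nonneg (x - y)]

theorem continuous_prox {ψ : E d → ℝ} (hψ : ConvexOn ℝ Set.univ ψ) {η : ℝ} (hη : 0 < η) :
    Continuous (prox η ψ) :=
  (LipschitzWith.of_dist_le_mul (K := 1) fun x y => by
    simpa [dist_eq_norm] using norm_prox_sub_prox_le hψ hη x y).continuous

theorem norm_mean_le (hn : 0 < n) {v : Fin n → E d} {c : ℝ} (h : ∀ i, ‖v i‖ ≤ c) :
    ‖(1 / (n : ℝ)) • ∑ i, v i‖ ≤ c := by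
  have hn' : (0 : ℝ) < n := by exact_mod_cast hn
  rw [norm_smul, Real.norm_of_nonneg (by positivity)]
  have := norm_sum_le_of_le Finset.univ (f := v) fun i _ => h i
  simp only [Finset.sum_const, Finset.card_univ, Fintype.card_fin, nsmul_eq_mul] at this
  rw [one_div, inv_mul_le_iff₀ hn']
  exact this

namespace Problem.Regular

variable {p : Problem d n} {L σ : ℝ}

theorem hasGradientAt_loss (hp : p.Regular L σ) (x : E d) :
    HasGradientAt p.loss ((1 / (n : ℝ)) • ∑ i, gradient (p.comp i) x) x := by
  have h : HasFDerivAt (fun x => (1 / (n : ℝ)) * ∑ i, p.comp i x)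
      ((1 / (n : ℝ)) • ∑ i, InnerProductSpace.toDual ℝ (E d) (gradient (p.comp i) x)) x :=
    (HasFDerivAt.fun_sum fun i _ => (hp.differentiable i x).hasGradientAt.hasFDerivAt).const_mul _
  rw [hasGradientAt_iff_hasFDerivAt, map_smul, map_sum]
  exact h

theorem gradient_loss (hp : p.Regular L σ) (x : E d) :
    gradient p.loss x = (1 / (n : ℝ)) • ∑ i, gradient (p.comp i) x :=
  (hp.hasGradientAt_loss x).gradient

theorem differentiable_loss (hp : p.Regular L σ) : Differentiable ℝ p.loss := fun x =>
  (hp.hasGradientAt_loss x).differentiableAt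

theorem lipschitz_loss (hp : p.Regular L σ) (hn : 0 < n) (x y : E d) :
    ‖gradient p.loss x - gradient p.loss y‖ ≤ L * ‖x - y‖ := by
  rw [hp.gradient_loss, hp.gradient_loss, ← smul_sub, ← Finset.sum_sub_distrib]
  exact norm_mean_le hn fun i => hp.lipschitz i x y

theorem norm_gradient_le (hp : p.Regular L σ) (i : Fin n) (x : E d) :
    ‖gradient (p.comp i) x‖ ≤ |σ| := by
  have := abs_le_of_sq_le_sq' (by simpa using hp.bounded i x) (abs_nonneg σ)
  exact this.2

theorem continuous_gradient_loss (hp : p.Regular L σ) (hn : 0 < n) :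
    Continuous (gradient p.loss) :=
  (LipschitzWith.of_dist_le' fun x y => by
    simpa [dist_eq_norm] using hp.lipschitz_loss hn x y).continuous

theorem continuous_gradient (hp : p.Regular L σ) (i : Fin n) :
    Continuous (gradient (p.comp i)) :=
  (LipschitzWith.of_dist_le' fun x y => by
    simpa [dist_eq_norm] using hp.lipschitz i x y).continuous

theorem continuous_obj (hp : p.Regular L σ) : Continuous p.obj :=
  hp.differentiable_loss.continuous.add
    (continuousOn_univ.1 (hp.convex.continuousOn isOpen_univ))

/-- The smoothness bound from above at the proximal point y and from below at z combines with the
optimality condition tested at z; the three-point identity turns the inner product of x - y and z -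
y into squares. -/
theorem obj_prox_le (hp : p.Regular L σ) (hn : 0 < n) {η : ℝ} (hη : 0 < η) (x v z : E d) :
    p.obj (prox η p.reg (x - η • v)) ≤ p.obj z
      + Inner.inner ℝ (prox η p.reg (x - η • v) - z) (gradient p.loss x - v)
      + (L / 2 - 1 / (2 * η)) * ‖prox η p.reg (x - η • v) - x‖ ^ 2
      + (L / 2 + 1 / (2 * η)) * ‖z - x‖ ^ 2
      - 1 / (2 * η) * ‖prox η p.reg (x - η • v) - z‖ ^ 2 := by
  have h1 := prox_spec hp.convex hη (x - η • v) z
  set y := prox η p.reg (x - η • v)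
  have h2 := abs_le.1
    (abs_sub_sub_inner_gradient_le hp.differentiable_loss (hp.lipschitz_loss hn) x y)
  have h3 := abs_le.1
    (abs_sub_sub_inner_gradient_le hp.differentiable_loss (hp.lipschitz_loss hn) x z)
  have e1 : 1 / η * Inner.inner ℝ (x - η • v - y) (z - y)
      = 1 / η * Inner.inner ℝ (x - y) (z - y) - Inner.inner ℝ v (z - y) := by
    rw [show x - η • v - y = (x - y) - η • v by module, inner_sub_left, inner_smul_left]
    simp only [conj_trivial]
    field_simp
  have e2 : ‖z - x‖ ^ 2 = ‖y - z‖ ^ 2 - 2 * Inner.inner ℝ (x - y) (z - y) + ‖y - x‖ ^ 2 := by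
    have := norm_sub_sq_real (z - y) (x - y)
    rw [show z - y - (x - y) = z - x by abel, real_inner_comm, norm_sub_rev z y,
      norm_sub_rev x y] at this
    exact this
  have e3 : Inner.inner ℝ (y - z) (gradient p.loss x - v) =
      Inner.inner ℝ (gradient p.loss x) (y - x) - Inner.inner ℝ (gradient p.loss x) (z - x)
        + Inner.inner ℝ v (z - y) := by
    rw [real_inner_comm]
    simp only [inner_sub_left, inner_sub_right]
    ring
  rw [e1] at h1
  have e4 : 1 / η * Inner.inner ℝ (x - y) (z - y)
      = 1 / (2 * η) * (‖y - z‖ ^ 2 + ‖y - x‖ ^ 2 - ‖z - x‖ ^ 2) := by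
    rw [e2]; field_simp; ring
  simp only [Problem.obj]
  rw [e3]
  linarith

/-- The exact step w = Prox(x - η∇f(x)) is an intermediate point: F(w) is compared with F(x), then
F(y) with F(w). The coefficients of ‖w - x‖² add up to L - 1/(2η), which is -γ after rescaling to
the gradient mapping. -/
theorem obj_prox_add_sq_gradMap_le (hp : p.Regular L σ) (hn : 0 < n) {η : ℝ} (hη : 0 < η)
    (hηL : η * L ≤ 1) (x v : E d) :
    p.obj (prox η p.reg (x - η • v)) + (η / 2 - η ^ 2 * L) * ‖gradMap p η x‖ ^ 2
      ≤ p.obj x + η / 2 * ‖v - gradient p.loss x‖ ^ 2 := by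
  have h1 := hp.obj_prox_le hn hη x (gradient p.loss x) x
  have h2 := hp.obj_prox_le hn hη x v (prox η p.reg (x - η • gradient p.loss x))
  have hg : ‖gradMap p η x‖ ^ 2
      = 1 / η ^ 2 * ‖prox η p.reg (x - η • gradient p.loss x) - x‖ ^ 2 := by
    rw [gradMap, norm_smul, mul_pow, norm_sub_rev x]
    simp
  rw [hg]
  set y := prox η p.reg (x - η • v)
  set w := prox η p.reg (x - η • gradient p.loss x)
  simp only [sub_self, inner_zero_right, norm_zero] at h1
  have h3 := real_inner_le_norm (y - w) (gradient p.loss x - v)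
  rw [norm_sub_rev (gradient p.loss x) v] at h3
  -- Young's inequality with the weight that exactly consumes the term -‖y - w‖²/(2η) in `h2`.
  have h4 : ‖y - w‖ * ‖v - gradient p.loss x‖
      ≤ 1 / (2 * η) * ‖y - w‖ ^ 2 + η / 2 * ‖v - gradient p.loss x‖ ^ 2 := by
    have e : 1 / (2 * η) * ‖y - w‖ ^ 2 + η / 2 * ‖v - gradient p.loss x‖ ^ 2
        - ‖y - w‖ * ‖v - gradient p.loss x‖
        = 1 / (2 * η) * (‖y - w‖ - η * ‖v - gradient p.loss x‖) ^ 2 := by field_simp; ring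
    have : 0 ≤ 1 / (2 * η) * (‖y - w‖ - η * ‖v - gradient p.loss x‖) ^ 2 := by positivity
    linarith
  have h5 : (L / 2 - 1 / (2 * η)) * ‖y - x‖ ^ 2 ≤ 0 := by
    refine mul_nonpos_of_nonpos_of_nonneg ?_ (sq_nonneg _)
    have : L ≤ 1 / η := by rw [le_div_iff₀ hη]; linarith
    have e : 1 / (2 * η) = 1 / η / 2 := by field_simp
    linarith
  have e5 : (η / 2 - η ^ 2 * L) * (1 / η ^ 2 * ‖w - x‖ ^ 2)
      = (1 / (2 * η) - L) * ‖w - x‖ ^ 2 := by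
    field_simp
  rw [e5]
  linarith

/-- With v the exact gradient the error term vanishes, and F at the new point is at least the
minimum. -/
theorem sq_gradMap_le (hp : p.Regular L σ) (hn : 0 < n) {η : ℝ} (hη : 0 < η)
    (hηL : η * L ≤ 1) {xo : E d} (ho : p.IsOptimal xo) (x : E d) :
    (η / 2 - η ^ 2 * L) * ‖gradMap p η x‖ ^ 2 ≤ p.obj x - p.obj xo := by
  have h := hp.obj_prox_add_sq_gradMap_le hn hη hηL x (gradient p.loss x)
  simp only [sub_self, norm_zero] at h
  have := ho (prox η p.reg (x - η • gradient p.loss x))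
  linarith

theorem continuous_gradMap (hp : p.Regular L σ) (hn : 0 < n) {η : ℝ} (hη : 0 < η) :
    Continuous (gradMap p η) := by
  have h1 := continuous_prox hp.convex hη
  have h2 := hp.continuous_gradient_loss hn
  unfold gradMap
  fun_prop

end Problem.Regular

/-! ### Moments of the standard Gaussian -/

section Moments

theorem integrable_pow_gaussianReal (k : ℕ) : Integrable (fun x : ℝ => x ^ k) (gaussianReal 0 1) := by
  have h := (memLp_id_gaussianReal' (μ := 0) (v := 1) (k : ENNReal) (by simp)).integrable_norm_pow'
  refine (integrable_norm_iff (by fun_prop)).1 ?_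
  simpa using h

/-- Integration by parts, since the density φ satisfies φ'(x) = -xφ(x). -/
theorem integral_pow_add_two_gaussianReal (k : ℕ) :
    ∫ x, x ^ (k + 2) ∂gaussianReal 0 1 = (k + 1) * ∫ x, x ^ k ∂gaussianReal 0 1 := by
  have hint : ∀ j : ℕ, Integrable (fun x : ℝ => x ^ j * gaussianPDFReal 0 1 x) := by
    intro j
    have h := integrable_pow_gaussianReal j
    rw [gaussianReal_of_var_ne_zero _ one_ne_zero,
      integrable_withDensity_iff_integrable_smul' (measurable_gaussianPDF 0 1)
        (by simp [gaussianPDF_lt_top])] at h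
    refine h.congr (Filter.Eventually.of_forall fun x => ?_)
    simp [toReal_gaussianPDF, mul_comm]
  have hderiv : ∀ x, HasDerivAt (gaussianPDFReal 0 1) (-x * gaussianPDFReal 0 1 x) x := by
    intro x
    have h1 : HasDerivAt (fun x : ℝ => -(x - 0) ^ 2 / (2 * ((1 : NNReal) : ℝ))) (-x) x := by
      have := ((((hasDerivAt_id x).sub_const 0).pow 2).neg).div_const (2 * ((1 : NNReal) : ℝ))
      refine this.congr_deriv ?_
      simp [neg_div]
    have h2 := h1.exp.const_mul (√(2 * Real.pi * ((1 : NNReal) : ℝ)))⁻¹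
    refine h2.congr_deriv ?_
    rw [gaussianPDFReal]; ring
  have hparts := integral_mul_deriv_eq_deriv_mul_of_integrable
    (u := fun x : ℝ => x ^ (k + 1)) (u' := fun x => (k + 1) * x ^ k)
    (v := gaussianPDFReal 0 1) (v' := fun x => -x * gaussianPDFReal 0 1 x)
    (fun x _ => by simpa using hasDerivAt_pow (k + 1) x) (fun x _ => hderiv x)
    ((hint (k + 2)).neg.congr (Filter.Eventually.of_forall fun x => by
      simp only [Pi.neg_apply, Pi.mul_apply]; ring))
    (((hint k).const_mul (k + 1 : ℝ)).congr (Filter.Eventually.of_forall fun x => by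
      simp only [Pi.mul_apply]; ring))
    (hint (k + 1))
  rw [integral_gaussianReal_eq_integral_smul one_ne_zero,
    integral_gaussianReal_eq_integral_smul one_ne_zero, ← integral_const_mul]
  have e1 : ∀ x : ℝ, gaussianPDFReal 0 1 x • x ^ (k + 2)
      = -(x ^ (k + 1) * (-x * gaussianPDFReal 0 1 x)) := fun x => by
    rw [smul_eq_mul]; ring
  have e2 : ∀ x : ℝ, (k + 1 : ℝ) * (gaussianPDFReal 0 1 x • x ^ k)
      = (k + 1) * x ^ k * gaussianPDFReal 0 1 x := fun x => by
    rw [smul_eq_mul]; ring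
  simp_rw [e1, e2]
  rw [integral_neg, hparts, neg_neg]

theorem integral_sq_gaussianReal : ∫ x, x ^ 2 ∂gaussianReal 0 1 = 1 := by
  have := integral_pow_add_two_gaussianReal 0
  simpa using this

theorem integral_pow_four_gaussianReal : ∫ x, x ^ 4 ∂gaussianReal 0 1 = 3 := by
  have := integral_pow_add_two_gaussianReal 2
  rw [integral_sq_gaussianReal] at this
  norm_num at this
  exact this

theorem integral_pow_six_gaussianReal : ∫ x, x ^ 6 ∂gaussianReal 0 1 = 15 := by
  have := integral_pow_add_two_gaussianReal 4
  rw [integral_pow_four_gaussianReal] at this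
  norm_num at this
  exact this

variable {d : ℕ}

theorem integrable_norm_pow_stdGaussian (k : ℕ) :
    Integrable (fun u : E d => ‖u‖ ^ k) (stdGaussian (E d)) := by
  have h := (IsGaussian.memLp_id (stdGaussian (E d)) (k : ENNReal) (by simp)).integrable_norm_pow'
  simpa using h

theorem integral_inner_pow_stdGaussian (g : E d) (k : ℕ) :
    ∫ u, Inner.inner ℝ g u ^ k ∂stdGaussian (E d) = ‖g‖ ^ k * ∫ x, x ^ k ∂gaussianReal 0 1 := by
  have hmap : (stdGaussian (E d)).map (innerSL ℝ g) = (gaussianReal 0 1).map (fun x => ‖g‖ * x) := by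
    rw [IsGaussian.map_eq_gaussianReal, integral_strongDual_stdGaussian,
      variance_dual_stdGaussian, gaussianReal_map_const_mul, mul_zero, mul_one]
    congr 1
    ext
    simp
  have h1 : ∫ u, Inner.inner ℝ g u ^ k ∂stdGaussian (E d)
      = ∫ y, y ^ k ∂((stdGaussian (E d)).map (innerSL ℝ g)) := by
    rw [integral_map (by fun_prop) (by fun_prop)]
    simp
  rw [h1, hmap, integral_map (by fun_prop) (by fun_prop), ← integral_const_mul]
  simp only [mul_pow]

theorem integrable_of_norm_le_mul_pow {g : E d → ℝ} (hg : Measurable g) (c : ℝ) (k : ℕ)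
    (h : ∀ u, |g u| ≤ c * ‖u‖ ^ k) : Integrable g (stdGaussian (E d)) :=
  ((integrable_norm_pow_stdGaussian k).const_mul c).mono' hg.aestronglyMeasurable
    (Filter.Eventually.of_forall h)

theorem integrable_inner_pow_stdGaussian (g : E d) (k : ℕ) :
    Integrable (fun u => Inner.inner ℝ g u ^ k) (stdGaussian (E d)) :=
  integrable_of_norm_le_mul_pow (by fun_prop) (‖g‖ ^ k) k fun u => by
    rw [abs_pow, ← mul_pow]
    exact pow_le_pow_left₀ (abs_nonneg _) (abs_real_inner_le_norm _ _) _

theorem integral_inner_sq_stdGaussian (g : E d) :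
    ∫ u, Inner.inner ℝ g u ^ 2 ∂stdGaussian (E d) = ‖g‖ ^ 2 := by
  rw [integral_inner_pow_stdGaussian, integral_sq_gaussianReal, mul_one]

/-- The identity 12a²b² = (a+b)⁴ + (a-b)⁴ - 2a⁴ - 2b⁴ reduces the mixed moment to fourth moments of
one-dimensional projections. -/
theorem integral_inner_sq_mul_inner_sq_stdGaussian (g e : E d) :
    ∫ u, Inner.inner ℝ g u ^ 2 * Inner.inner ℝ e u ^ 2 ∂stdGaussian (E d)
      = ‖g‖ ^ 2 * ‖e‖ ^ 2 + 2 * Inner.inner ℝ g e ^ 2 := by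
  have h : ∀ u : E d, Inner.inner ℝ g u ^ 2 * Inner.inner ℝ e u ^ 2
      = (1 / 12 : ℝ) * (Inner.inner ℝ (g + e) u ^ 4 + Inner.inner ℝ (g - e) u ^ 4
        - (2 * Inner.inner ℝ g u ^ 4 + 2 * Inner.inner ℝ e u ^ 4)) := by
    intro u
    rw [inner_add_left, inner_sub_left]
    ring
  have I := fun g : E d => integrable_inner_pow_stdGaussian g 4
  have I1 : Integrable (fun u => Inner.inner ℝ (g + e) u ^ 4 + Inner.inner ℝ (g - e) u ^ 4)
      (stdGaussian (E d)) := (I _).add (I _)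
  have I2 : Integrable (fun u => 2 * Inner.inner ℝ g u ^ 4 + 2 * Inner.inner ℝ e u ^ 4)
      (stdGaussian (E d)) := ((I _).const_mul 2).add ((I _).const_mul 2)
  simp_rw [h]
  rw [integral_const_mul, integral_sub I1 I2, integral_add (I _) (I _),
    integral_add ((I _).const_mul 2) ((I _).const_mul 2), integral_const_mul, integral_const_mul]
  simp only [integral_inner_pow_stdGaussian, integral_pow_four_gaussianReal]
  have e1 : ‖g + e‖ ^ 4 = (‖g‖ ^ 2 + 2 * Inner.inner ℝ g e + ‖e‖ ^ 2) ^ 2 := by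
    rw [← norm_add_sq_real]; ring
  have e2 : ‖g - e‖ ^ 4 = (‖g‖ ^ 2 - 2 * Inner.inner ℝ g e + ‖e‖ ^ 2) ^ 2 := by
    rw [← norm_sub_sq_real]; ring
  rw [e1, e2]
  ring

theorem integral_inner_sq_mul_norm_sq_stdGaussian (g : E d) :
    ∫ u, Inner.inner ℝ g u ^ 2 * ‖u‖ ^ 2 ∂stdGaussian (E d) = (d + 2) * ‖g‖ ^ 2 := by
  have hn : ∀ v : E d, ‖v‖ ^ 2
      = ∑ i, Inner.inner ℝ (EuclideanSpace.basisFun (Fin d) ℝ i) v ^ 2 := by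
    intro v
    rw [← (EuclideanSpace.basisFun (Fin d) ℝ).sum_sq_norm_inner_right v]
    simp
  have h : ∀ u : E d, Inner.inner ℝ g u ^ 2 * ‖u‖ ^ 2
      = ∑ i, Inner.inner ℝ g u ^ 2
        * Inner.inner ℝ (EuclideanSpace.basisFun (Fin d) ℝ i) u ^ 2 := by
    intro u
    rw [hn u, Finset.mul_sum]
  simp_rw [h]
  rw [integral_finsetSum]
  · simp_rw [integral_inner_sq_mul_inner_sq_stdGaussian]
    rw [Finset.sum_add_distrib, ← Finset.mul_sum, ← Finset.mul_sum]
    simp_rw [real_inner_comm _ g]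
    rw [← hn g]
    simp
    ring
  · intro i _
    refine integrable_of_norm_le_mul_pow (by fun_prop)
      (‖g‖ ^ 2 * ‖EuclideanSpace.basisFun (Fin d) ℝ i‖ ^ 2) 4 fun u => ?_
    rw [abs_mul, abs_pow, abs_pow]
    have h1 := pow_le_pow_left₀ (abs_nonneg _) (abs_real_inner_le_norm g u) 2
    have h2 := pow_le_pow_left₀ (abs_nonneg _)
      (abs_real_inner_le_norm (EuclideanSpace.basisFun (Fin d) ℝ i) u) 2
    refine (mul_le_mul h1 h2 (by positivity) (by positivity)).trans (le_of_eq ?_)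
    ring

/-- 1, 3, 15 are the moments of the square of a standard normal variable, so these are the
chi-square moments. Adding one independent summand at a time avoids a multinomial expansion. -/
theorem iIndepFun.moments_sum {ι Ω : Type*} [MeasurableSpace Ω] {P : Measure Ω}
    [IsProbabilityMeasure P] {Y : ι → Ω → ℝ} (hY : iIndepFun Y P) (hm : ∀ i, Measurable (Y i))
    (hi : ∀ i k, Integrable (fun ω => Y i ω ^ k) P) (h1 : ∀ i, ∫ ω, Y i ω ∂P = 1)
    (h2 : ∀ i, ∫ ω, Y i ω ^ 2 ∂P = 3) (h3 : ∀ i, ∫ ω, Y i ω ^ 3 ∂P = 15) (s : Finset ι) :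
    (∀ k, k ≤ 3 → Integrable (fun ω => (∑ i ∈ s, Y i ω) ^ k) P) ∧
    ∫ ω, (∑ i ∈ s, Y i ω) ∂P = s.card ∧
    ∫ ω, (∑ i ∈ s, Y i ω) ^ 2 ∂P = s.card * (s.card + 2) ∧
    ∫ ω, (∑ i ∈ s, Y i ω) ^ 3 ∂P = s.card * (s.card + 2) * (s.card + 4) := by
  classical
  induction s using Finset.induction_on with
  | empty =>
    refine ⟨fun k _ => ?_, by simp, by simp, by simp⟩
    simp only [Finset.sum_empty]
    exact integrable_const _
  | insert a s ha ih =>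
    obtain ⟨iX, m1, m2, m3⟩ := ih
    set X : Ω → ℝ := fun ω => ∑ i ∈ s, Y i ω with hX
    have hXm : Measurable X := by fun_prop
    have hind : IndepFun (Y a) X P := by
      have := (hY.indepFun_finsetSum_of_notMem hm ha).symm
      have e : (∑ i ∈ s, Y i) = X := by ext; simp [hX]
      rwa [e] at this
    have hindp : ∀ j k : ℕ, IndepFun (fun ω => Y a ω ^ j) (fun ω => X ω ^ k) P := fun j k =>
      hind.comp (φ := fun x => x ^ j) (ψ := fun x => x ^ k) (by fun_prop) (by fun_prop)
    have ip : ∀ j k : ℕ, k ≤ 3 → Integrable (fun ω => Y a ω ^ j * X ω ^ k) P := fun j k hk =>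
      IndepFun.integrable_mul (hindp j k) (hi a j) (iX k hk)
    have mp : ∀ j k : ℕ, ∫ ω, Y a ω ^ j * X ω ^ k ∂P = (∫ ω, Y a ω ^ j ∂P) * ∫ ω, X ω ^ k ∂P :=
      fun j k => (hindp j k).integral_fun_mul_eq_mul_integral
        (by fun_prop) (by fun_prop)
    have i1 := hi a 1
    simp only [pow_one] at i1
    have iX1 := iX 1 (by norm_num)
    simp only [pow_one] at iX1
    have e11 := mp 1 1
    have e12 := mp 1 2
    have e21 := mp 2 1
    have j11 := ip 1 1 (by norm_num)
    have j12 := ip 1 2 (by norm_num)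
    have j21 := ip 2 1 (by norm_num)
    simp only [pow_one, h1, h2] at e11 e12 e21 j11 j12 j21
    have sq : ∀ ω, (Y a ω + X ω) ^ 2 = Y a ω ^ 2 + 2 * (Y a ω * X ω) + X ω ^ 2 := fun ω => by ring
    have cu : ∀ ω, (Y a ω + X ω) ^ 3
        = Y a ω ^ 3 + 3 * (Y a ω ^ 2 * X ω) + 3 * (Y a ω * X ω ^ 2) + X ω ^ 3 := fun ω => by ring
    have k2 : Integrable (fun ω => Y a ω ^ 2 + 2 * (Y a ω * X ω)) P :=
      (hi a 2).add (j11.const_mul 2)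
    have k3 : Integrable (fun ω => Y a ω ^ 3 + 3 * (Y a ω ^ 2 * X ω)) P :=
      (hi a 3).add (j21.const_mul 3)
    have k3' : Integrable
        (fun ω => Y a ω ^ 3 + 3 * (Y a ω ^ 2 * X ω) + 3 * (Y a ω * X ω ^ 2)) P :=
      k3.add (j12.const_mul 3)
    simp only [Finset.sum_insert ha, Finset.card_insert_of_notMem ha]
    change (∀ k, k ≤ 3 → Integrable (fun ω => (Y a ω + X ω) ^ k) P) ∧ ∫ ω, (Y a ω + X ω) ∂P = _ ∧
      ∫ ω, (Y a ω + X ω) ^ 2 ∂P = _ ∧ ∫ ω, (Y a ω + X ω) ^ 3 ∂P = _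
    refine ⟨fun k hk => ?_, ?_, ?_, ?_⟩
    · interval_cases k
      · simp
      · simp only [pow_one]; exact i1.add iX1
      · simp_rw [sq]; exact k2.add (iX 2 (by norm_num))
      · simp_rw [cu]; exact k3'.add (iX 3 le_rfl)
    · rw [integral_add i1 iX1, h1, m1]; push_cast; ring
    · simp_rw [sq]
      rw [integral_add k2 (iX 2 (by norm_num)), integral_add (hi a 2) (j11.const_mul 2),
        integral_const_mul, e11, h2, m2, m1]
      push_cast; ring
    · simp_rw [cu]
      rw [integral_add k3' (iX 3 le_rfl), integral_add k3 (j12.const_mul 3),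
        integral_add (hi a 3) (j21.const_mul 3), integral_const_mul, integral_const_mul, e12, e21,
        h3, m3, m2, m1]
      push_cast; ring

theorem integral_norm_pow_six_stdGaussian :
    ∫ u, ‖u‖ ^ 6 ∂stdGaussian (E d) = d * (d + 2) * (d + 4) := by
  have hmap := map_pi_eq_stdGaussian (ι := Fin d)
  rw [← hmap, integral_map (by fun_prop) (by fun_prop)]
  have hev : ∀ (i : Fin d) (k : ℕ),
      Integrable (fun x : Fin d → ℝ => x i ^ k) (Measure.pi fun _ => gaussianReal 0 1) ∧
      ∫ x : Fin d → ℝ, x i ^ k ∂(Measure.pi fun _ => gaussianReal 0 1)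
        = ∫ y, y ^ k ∂gaussianReal 0 1 := by
    intro i k
    have hp := measurePreserving_eval (fun _ : Fin d => gaussianReal 0 1) i
    exact ⟨hp.integrable_comp_of_integrable (integrable_pow_gaussianReal k),
      hp.hasLaw.integral_comp (f := fun y => y ^ k) (by fun_prop)⟩
  have h := (iIndepFun.moments_sum (P := Measure.pi fun _ : Fin d => gaussianReal 0 1)
    (Y := fun i x => x i ^ 2)
    (iIndepFun_pi (X := fun _ x => x ^ 2) fun i => by fun_prop) (fun i => by fun_prop)
    (fun i k => by simpa only [← pow_mul] using (hev i (2 * k)).1)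
    (fun i => by rw [(hev i 2).2, integral_sq_gaussianReal])
    (fun i => by simp only [← pow_mul]; rw [(hev i _).2, integral_pow_four_gaussianReal])
    (fun i => by simp only [← pow_mul]; rw [(hev i _).2, integral_pow_six_gaussianReal])
    Finset.univ).2.2.2
  simp only [Finset.card_univ, Fintype.card_fin] at h
  rw [← h]
  congr 1
  ext x
  rw [show 6 = 2 * 3 by norm_num, pow_mul, EuclideanSpace.norm_sq_eq]
  simp

end Moments

/-! ### The Gaussian smoothing estimator at a fixed point -/

section Estimator

variable {d n : ℕ} {p : Problem d n} {L σ μ : ℝ}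

theorem norm_add_sq_le_two_mul {V : Type*} [SeminormedAddCommGroup V] (x y : V) :
    ‖x + y‖ ^ 2 ≤ 2 * ‖x‖ ^ 2 + 2 * ‖y‖ ^ 2 := by
  have := norm_add_le x y
  nlinarith [sq_nonneg (‖x‖ - ‖y‖), norm_nonneg (x + y)]

theorem measurable_gauSGE {h : E d → ℝ} (hh : Continuous h) {α : Type*} [MeasurableSpace α]
    {x u : α → E d} (hx : Measurable x) (hu : Measurable u) :
    Measurable fun a => gauSGE μ h (x a) (u a) := by
  have h1 : Measurable fun a => h (x a + μ • u a) := hh.measurable.comp (hx.add (hu.const_smul μ))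
  have h2 : Measurable fun a => h (x a) := hh.measurable.comp hx
  exact ((h1.sub h2).div_const μ).smul hu

namespace Problem.Regular

/-- By the mean value inequality. This cruder bound secures integrability; the moment bounds come
from the expansion around ⟨∇f_i(x), u⟩u. -/
theorem norm_gauSGE_le (hp : p.Regular L σ) (hμ : 0 < μ) (i : Fin n) (x u : E d) :
    ‖gauSGE μ (p.comp i) x u‖ ≤ |σ| * ‖u‖ ^ 2 := by
  have h := convex_univ.norm_image_sub_le_of_norm_fderiv_le (𝕜 := ℝ) (f := p.comp i) (C := |σ|)
    (fun z _ => hp.differentiable i z)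
    (fun z _ => by
      have := hp.norm_gradient_le i z
      rwa [gradient, LinearIsometryEquiv.norm_map] at this)
    (Set.mem_univ x) (Set.mem_univ (x + μ • u))
  rw [add_sub_cancel_left, norm_smul, Real.norm_of_nonneg hμ.le, Real.norm_eq_abs] at h
  rw [gauSGE, norm_smul, Real.norm_eq_abs, abs_div, abs_of_pos hμ, pow_two, ← mul_assoc]
  refine mul_le_mul_of_nonneg_right ?_ (norm_nonneg _)
  rw [div_le_iff₀ hμ]
  linarith

theorem norm_gauSGE_sub_le (hp : p.Regular L σ) (hμ : 0 < μ) (i : Fin n) (x u : E d) :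
    ‖gauSGE μ (p.comp i) x u - Inner.inner ℝ (gradient (p.comp i) x) u • u‖
      ≤ L * μ / 2 * ‖u‖ ^ 3 := by
  have h := abs_sub_sub_inner_gradient_le (hp.differentiable i) (hp.lipschitz i) x (x + μ • u)
  rw [add_sub_cancel_left, norm_smul, Real.norm_of_nonneg hμ.le, inner_smul_right] at h
  rw [gauSGE, ← sub_smul, norm_smul, Real.norm_eq_abs]
  have e : (p.comp i (x + μ • u) - p.comp i x) / μ - Inner.inner ℝ (gradient (p.comp i) x) u
      = (p.comp i (x + μ • u) - p.comp i x - μ * Inner.inner ℝ (gradient (p.comp i) x) u) / μ := by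
    field_simp
  rw [e, abs_div, abs_of_pos hμ, div_mul_eq_mul_div, div_le_iff₀ hμ]
  calc _ ≤ L / 2 * (μ * ‖u‖) ^ 2 * ‖u‖ := mul_le_mul_of_nonneg_right h (norm_nonneg _)
    _ = _ := by ring

theorem sq_norm_gauSGE_sub_le (hp : p.Regular L σ) (hμ : 0 < μ) (i : Fin n) (x u : E d) :
    ‖gauSGE μ (p.comp i) x u - Inner.inner ℝ (gradient (p.comp i) x) u • u‖ ^ 2
      ≤ L ^ 2 * μ ^ 2 / 4 * ‖u‖ ^ 6 := by
  refine (pow_le_pow_left₀ (norm_nonneg _) (hp.norm_gauSGE_sub_le hμ i x u) 2).trans (le_of_eq ?_)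
  ring

theorem integral_sq_gauSGE_le (hp : p.Regular L σ) (hμ : 0 < μ) (i : Fin n) (x : E d) :
    ∫ u, ‖gauSGE μ (p.comp i) x u‖ ^ 2 ∂stdGaussian (E d)
      ≤ 2 * (d + 2) * σ ^ 2 + L ^ 2 * μ ^ 2 / 2 * (d * (d + 2) * (d + 4)) := by
  set g := gradient (p.comp i) x with hg
  have hc := (hp.differentiable i).continuous
  have hpt : ∀ u, ‖gauSGE μ (p.comp i) x u‖ ^ 2
      ≤ 2 * (Inner.inner ℝ g u ^ 2 * ‖u‖ ^ 2) + L ^ 2 * μ ^ 2 / 2 * ‖u‖ ^ 6 := by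
    intro u
    have h1 := norm_add_sq_le_two_mul (gauSGE μ (p.comp i) x u - Inner.inner ℝ g u • u)
      (Inner.inner ℝ g u • u)
    rw [sub_add_cancel, norm_smul, mul_pow, Real.norm_eq_abs, sq_abs] at h1
    have h2 := hp.sq_norm_gauSGE_sub_le hμ i x u
    linarith
  have i1 : Integrable (fun u : E d => Inner.inner ℝ g u ^ 2 * ‖u‖ ^ 2) (stdGaussian (E d)) :=
    integrable_of_norm_le_mul_pow (by fun_prop) (‖g‖ ^ 2) 4 fun u => by
      rw [abs_mul, abs_pow, abs_pow, abs_norm]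
      have h1 := pow_le_pow_left₀ (abs_nonneg _) (abs_real_inner_le_norm g u) 2
      nlinarith [mul_le_mul_of_nonneg_right h1 (sq_nonneg ‖u‖)]
  have i2 := integrable_norm_pow_stdGaussian (d := d) 6
  have i0 : Integrable (fun u => ‖gauSGE μ (p.comp i) x u‖ ^ 2) (stdGaussian (E d)) :=
    integrable_of_norm_le_mul_pow (by unfold gauSGE; fun_prop) (σ ^ 2) 4 fun u => by
      rw [abs_pow, abs_norm]
      refine (pow_le_pow_left₀ (norm_nonneg _) (hp.norm_gauSGE_le hμ i x u) 2).trans (le_of_eq ?_)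
      rw [mul_pow, sq_abs]; ring
  refine (integral_mono i0 ((i1.const_mul 2).add (i2.const_mul _)) hpt).trans ?_
  simp only [Pi.add_apply]
  rw [integral_add (i1.const_mul 2) (i2.const_mul _), integral_const_mul, integral_const_mul,
    integral_inner_sq_mul_norm_sq_stdGaussian, integral_norm_pow_six_stdGaussian]
  have h3 : (d + 2 : ℝ) * ‖g‖ ^ 2 ≤ (d + 2) * σ ^ 2 :=
    mul_le_mul_of_nonneg_left (hp.bounded i x) (by positivity)
  linarith

/-- The linear part ⟨g,u⟩u - g has second moment (d + 2) - 2 + 1 = d + 1 times ‖g‖²; the factor 2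
comes from splitting off the Taylor remainder. -/
theorem integral_sq_gauSGE_sub_gradient_le (hp : p.Regular L σ) (hμ : 0 < μ) (i : Fin n)
    (x : E d) :
    ∫ u, ‖gauSGE μ (p.comp i) x u - gradient (p.comp i) x‖ ^ 2 ∂stdGaussian (E d)
      ≤ 2 * (d + 1) * σ ^ 2 + L ^ 2 * μ ^ 2 / 2 * (d * (d + 2) * (d + 4)) := by
  set g := gradient (p.comp i) x with hg
  have hpt : ∀ u, ‖gauSGE μ (p.comp i) x u - g‖ ^ 2
      ≤ 2 * (Inner.inner ℝ g u ^ 2 * ‖u‖ ^ 2) + (2 * ‖g‖ ^ 2 - 4 * Inner.inner ℝ g u ^ 2)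
        + L ^ 2 * μ ^ 2 / 2 * ‖u‖ ^ 6 := by
    intro u
    have h1 := norm_add_sq_le_two_mul (gauSGE μ (p.comp i) x u - Inner.inner ℝ g u • u)
      (Inner.inner ℝ g u • u - g)
    rw [sub_add_sub_cancel, norm_sub_sq_real (Inner.inner ℝ g u • u) g, norm_smul, mul_pow,
      Real.norm_eq_abs, sq_abs, inner_smul_left, real_inner_comm g u, conj_trivial] at h1
    have h2 := hp.sq_norm_gauSGE_sub_le hμ i x u
    nlinarith
  have i1 : Integrable (fun u : E d => Inner.inner ℝ g u ^ 2 * ‖u‖ ^ 2) (stdGaussian (E d)) :=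
    integrable_of_norm_le_mul_pow (by fun_prop) (‖g‖ ^ 2) 4 fun u => by
      rw [abs_mul, abs_pow, abs_pow, abs_norm]
      have h1 := pow_le_pow_left₀ (abs_nonneg _) (abs_real_inner_le_norm g u) 2
      nlinarith [mul_le_mul_of_nonneg_right h1 (sq_nonneg ‖u‖)]
  have i2 := integrable_norm_pow_stdGaussian (d := d) 6
  have i3 : Integrable (fun u : E d => 2 * ‖g‖ ^ 2 - 4 * Inner.inner ℝ g u ^ 2)
      (stdGaussian (E d)) :=
    (integrable_const _).sub ((integrable_inner_pow_stdGaussian g 2).const_mul 4)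
  have i4 : Integrable (fun u : E d => 2 * (Inner.inner ℝ g u ^ 2 * ‖u‖ ^ 2)
      + (2 * ‖g‖ ^ 2 - 4 * Inner.inner ℝ g u ^ 2)) (stdGaussian (E d)) := (i1.const_mul 2).add i3
  refine (integral_mono_of_nonneg (Filter.Eventually.of_forall fun u => sq_nonneg _)
    (i4.add (i2.const_mul _)) (Filter.Eventually.of_forall hpt)).trans ?_
  simp only [Pi.add_apply]
  rw [integral_add i4 (i2.const_mul _), integral_add (i1.const_mul 2) i3,
    integral_sub (integrable_const _) ((integrable_inner_pow_stdGaussian g 2).const_mul 4),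
    integral_const_mul, integral_const_mul, integral_const_mul, integral_const_mul,
    integral_inner_sq_mul_norm_sq_stdGaussian, integral_norm_pow_six_stdGaussian,
    integral_inner_sq_stdGaussian]
  simp only [integral_const, probReal_univ, one_smul]
  have h3 : (d + 1 : ℝ) * ‖g‖ ^ 2 ≤ (d + 1) * σ ^ 2 :=
    mul_le_mul_of_nonneg_left (hp.bounded i x) (by positivity)
  linarith

end Problem.Regular

end Estimator

/-! ### Variance of mini-batch means -/

section Batch

variable {V : Type*} [NormedAddCommGroup V] [InnerProductSpace ℝ V] {n b : ℕ}

theorem sum_comp_apply_of_perm_invariant {B : Finset (Fin b → Fin n)}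
    (hB : ∀ (π : Equiv.Perm (Fin n)) I, I ∈ B → ⇑π ∘ I ∈ B) (φ : (Fin b → Fin n) → ℝ)
    (π : Equiv.Perm (Fin n)) : ∑ I ∈ B, φ (π ∘ I) = ∑ I ∈ B, φ I := by
  refine Finset.sum_nbij' (fun I => π ∘ I) (fun I => π.symm ∘ I) (fun I hI => hB _ _ hI)
    (fun I hI => hB _ _ hI) (fun I _ => ?_) (fun I _ => ?_) (fun _ _ => rfl)
  all_goals ext; simp

/-- Averaging over the cyclic shifts of the labels shows that each index is equally likely at
position k. -/
theorem mul_sum_apply_of_perm_invariant {B : Finset (Fin b → Fin n)}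
    (hB : ∀ (π : Equiv.Perm (Fin n)) I, I ∈ B → ⇑π ∘ I ∈ B) (φ : Fin n → ℝ) (k : Fin b) :
    n * ∑ I ∈ B, φ (I k) = B.card * ∑ i, φ i := by
  rcases Nat.eq_zero_or_pos n with hn | hn
  · subst hn
    simp
  have : NeZero n := ⟨hn.ne'⟩
  have h1 : ∑ c : Fin n, ∑ I ∈ B, φ (Equiv.addRight c (I k)) = n * ∑ I ∈ B, φ (I k) := by
    have : ∀ c : Fin n, ∑ I ∈ B, φ (Equiv.addRight c (I k)) = ∑ I ∈ B, φ (I k) := fun c =>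
      sum_comp_apply_of_perm_invariant hB (fun I => φ (I k)) (Equiv.addRight c)
    rw [Finset.sum_congr rfl fun c _ => this c]
    simp
  have h2 : ∀ i : Fin n, ∑ c : Fin n, φ (Equiv.addRight c i) = ∑ j, φ j := fun i =>
    Equiv.sum_comp (Equiv.addLeft i) φ
  rw [← h1, Finset.sum_comm]
  simp_rw [h2]
  simp

/-- By symmetry the sum is the same for every second index l ≠ i. Over all l the total is zero
because y has mean zero, and the diagonal part is nonnegative. -/
theorem sum_perm_inner_nonpos {y : Fin n → V} (hy : ∑ i, y i = 0) {i j : Fin n} (hij : i ≠ j) :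
    ∑ π : Equiv.Perm (Fin n), Inner.inner ℝ (y (π i)) (y (π j)) ≤ 0 := by
  have heq : ∀ l, l ≠ i → ∑ π : Equiv.Perm (Fin n), Inner.inner ℝ (y (π i)) (y (π l))
      = ∑ π : Equiv.Perm (Fin n), Inner.inner ℝ (y (π i)) (y (π j)) := by
    intro l hl
    rw [← Equiv.sum_comp (Equiv.mulRight (Equiv.swap j l))
      fun π : Equiv.Perm (Fin n) => Inner.inner ℝ (y (π i)) (y (π l))]
    refine Finset.sum_congr rfl fun π _ => ?_
    simp [Equiv.swap_apply_of_ne_of_ne hij hl.symm]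
  have hzero : ∑ l, ∑ π : Equiv.Perm (Fin n), Inner.inner ℝ (y (π i)) (y (π l)) = 0 := by
    rw [Finset.sum_comm]
    refine Finset.sum_eq_zero fun π _ => ?_
    rw [← inner_sum, Equiv.sum_comp π y, hy, inner_zero_right]
  have hdiag : 0 ≤ ∑ π : Equiv.Perm (Fin n), Inner.inner ℝ (y (π i)) (y (π i)) :=
    Finset.sum_nonneg fun π _ => real_inner_self_nonneg
  rw [← Finset.add_sum_erase _ _ (Finset.mem_univ i),
    Finset.sum_congr rfl fun l hl => heq l (Finset.ne_of_mem_erase hl), Finset.sum_const,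
    nsmul_eq_mul] at hzero
  have hcard : (0 : ℝ) < ((Finset.univ.erase i).card : ℝ) := by
    exact_mod_cast Finset.card_pos.2 ⟨j, Finset.mem_erase.2 ⟨hij.symm, Finset.mem_univ _⟩⟩
  by_contra! h
  nlinarith [mul_pos hcard h]

theorem sum_inner_nonpos_of_injective {B : Finset (Fin b → Fin n)}
    (hB : ∀ (π : Equiv.Perm (Fin n)) I, I ∈ B → ⇑π ∘ I ∈ B)
    (hinj : ∀ I ∈ B, Function.Injective I) {y : Fin n → V} (hy : ∑ i, y i = 0) {k l : Fin b}
    (hkl : k ≠ l) : ∑ I ∈ B, Inner.inner ℝ (y (I k)) (y (I l)) ≤ 0 := by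
  have h1 : ∑ π : Equiv.Perm (Fin n), ∑ I ∈ B, Inner.inner ℝ (y (π (I k))) (y (π (I l)))
      = Fintype.card (Equiv.Perm (Fin n)) * ∑ I ∈ B, Inner.inner ℝ (y (I k)) (y (I l)) := by
    have : ∀ π : Equiv.Perm (Fin n), ∑ I ∈ B, Inner.inner ℝ (y (π (I k))) (y (π (I l)))
        = ∑ I ∈ B, Inner.inner ℝ (y (I k)) (y (I l)) := fun π =>
      sum_comp_apply_of_perm_invariant hB (fun I => Inner.inner ℝ (y (I k)) (y (I l))) π
    simp only [this, Finset.sum_const, Finset.card_univ, nsmul_eq_mul]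
  have h2 : ∑ π : Equiv.Perm (Fin n), ∑ I ∈ B, Inner.inner ℝ (y (π (I k))) (y (π (I l))) ≤ 0 := by
    rw [Finset.sum_comm]
    exact Finset.sum_nonpos fun I hI => sum_perm_inner_nonpos hy ((hinj I hI).ne hkl)
  rw [h1] at h2
  have hcard : (0 : ℝ) < Fintype.card (Equiv.Perm (Fin n)) := by exact_mod_cast Fintype.card_pos
  by_contra! h
  nlinarith [mul_pos hcard h]

/-- Shifting coordinate k alone permutes all tuples, fixes the l-th entry and moves the k-th through
every index, over which y sums to zero. -/
theorem sum_univ_inner_eq_zero {y : Fin n → V} (hy : ∑ i, y i = 0) {k l : Fin b} (hkl : k ≠ l) :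
    ∑ I : Fin b → Fin n, Inner.inner ℝ (y (I k)) (y (I l)) = 0 := by
  rcases Nat.eq_zero_or_pos n with hn | hn
  · subst hn
    exact Finset.sum_eq_zero fun I _ => (I k).elim0
  have : NeZero n := ⟨hn.ne'⟩
  have h1 : ∀ c : Fin n, ∑ I : Fin b → Fin n, Inner.inner ℝ (y (I k + c)) (y (I l))
      = ∑ I : Fin b → Fin n, Inner.inner ℝ (y (I k)) (y (I l)) := by
    intro c
    rw [← Equiv.sum_comp (Equiv.addRight (Pi.single k c : Fin b → Fin n))
      fun I : Fin b → Fin n => Inner.inner ℝ (y (I k)) (y (I l))]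
    simp [hkl.symm]
  have h2 : ∑ c : Fin n, ∑ I : Fin b → Fin n, Inner.inner ℝ (y (I k + c)) (y (I l)) = 0 := by
    rw [Finset.sum_comm]
    refine Finset.sum_eq_zero fun I _ => ?_
    rw [← sum_inner]
    have : ∑ c, y (I k + c) = ∑ c, y c := Equiv.sum_comp (Equiv.addLeft (I k)) y
    rw [this, hy, inner_zero_left]
  simp only [h1, Finset.sum_const, Finset.card_univ, Fintype.card_fin, nsmul_eq_mul] at h2
  exact (mul_eq_zero.1 h2).resolve_left (by exact_mod_cast hn.ne')

/-- Expand the square of the centred mean: the diagonal terms give the factor 1/b and the cross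
terms are discarded by `hcross`. Centring does not increase the sum of squares. -/
theorem sum_sq_norm_batch_sub_mean_le {B : Finset (Fin b → Fin n)} (hn : 0 < n) (hb : 0 < b)
    (hB : ∀ (π : Equiv.Perm (Fin n)) I, I ∈ B → ⇑π ∘ I ∈ B)
    (hcross : ∀ y : Fin n → V, ∑ i, y i = 0 → ∀ k l : Fin b, k ≠ l →
      ∑ I ∈ B, Inner.inner ℝ (y (I k)) (y (I l)) ≤ 0) (z : Fin n → V) :
    ∑ I ∈ B, ‖(1 / (b : ℝ)) • ∑ k, z (I k) - (1 / (n : ℝ)) • ∑ i, z i‖ ^ 2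
      ≤ B.card * (1 / b * (1 / n * ∑ i, ‖z i‖ ^ 2)) := by
  have hn' : (0 : ℝ) < n := by exact_mod_cast hn
  have hb' : (0 : ℝ) < b := by exact_mod_cast hb
  set c := (1 / (n : ℝ)) • ∑ i, z i with hc
  set y : Fin n → V := fun i => z i - c with hydef
  have hsum : ∑ i, z i = (n : ℝ) • c := by
    rw [hc, smul_smul, mul_one_div_cancel hn'.ne', one_smul]
  have hy : ∑ i, y i = 0 := by
    simp only [hydef, Finset.sum_sub_distrib, Finset.sum_const, Finset.card_univ,
      Fintype.card_fin, hsum]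
    rw [← Nat.cast_smul_eq_nsmul ℝ, sub_self]
  have hrew : ∀ I : Fin b → Fin n, (1 / (b : ℝ)) • ∑ k, z (I k) - c
      = (1 / (b : ℝ)) • ∑ k, y (I k) := by
    intro I
    simp only [hydef, Finset.sum_sub_distrib, Finset.sum_const, Finset.card_univ,
      Fintype.card_fin, smul_sub]
    rw [← Nat.cast_smul_eq_nsmul ℝ, smul_smul, one_div_mul_cancel hb'.ne', one_smul]
  have hyz : ∑ i, ‖y i‖ ^ 2 ≤ ∑ i, ‖z i‖ ^ 2 := by
    have h1 : ∀ i, ‖y i‖ ^ 2 = ‖z i‖ ^ 2 - 2 * Inner.inner ℝ (z i) c + ‖c‖ ^ 2 := fun i =>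
      norm_sub_sq_real _ _
    simp_rw [h1]
    rw [Finset.sum_add_distrib, Finset.sum_sub_distrib, ← Finset.mul_sum, ← sum_inner, hsum,
      inner_smul_left, real_inner_self_eq_norm_sq]
    simp only [conj_trivial, Finset.sum_const, Finset.card_univ, Fintype.card_fin, nsmul_eq_mul]
    nlinarith [mul_nonneg hn'.le (sq_nonneg ‖c‖)]
  have hdiag : ∀ k : Fin b, ∑ I ∈ B, Inner.inner ℝ (y (I k)) (y (I k))
      = B.card * (1 / n * ∑ i, ‖y i‖ ^ 2) := by
    intro k
    have := mul_sum_apply_of_perm_invariant hB (fun i => ‖y i‖ ^ 2) k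
    simp only [real_inner_self_eq_norm_sq]
    field_simp
    linarith
  have hmain : ∑ I ∈ B, ‖∑ k, y (I k)‖ ^ 2 ≤ b * (B.card * (1 / n * ∑ i, ‖y i‖ ^ 2)) := by
    have h1 : ∀ I : Fin b → Fin n, ‖∑ k, y (I k)‖ ^ 2
        = ∑ k, ∑ l, Inner.inner ℝ (y (I k)) (y (I l)) := by
      intro I
      rw [← real_inner_self_eq_norm_sq, sum_inner]
      simp_rw [inner_sum]
    simp_rw [h1]
    rw [Finset.sum_comm]
    have h2 : ∀ k : Fin b, ∑ I ∈ B, ∑ l, Inner.inner ℝ (y (I k)) (y (I l))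
        ≤ B.card * (1 / n * ∑ i, ‖y i‖ ^ 2) := by
      intro k
      rw [Finset.sum_comm, ← Finset.add_sum_erase _ _ (Finset.mem_univ k), hdiag k]
      have := Finset.sum_nonpos (s := Finset.univ.erase k)
        (f := fun l => ∑ I ∈ B, Inner.inner ℝ (y (I k)) (y (I l)))
        fun l hl => hcross y hy k l (Finset.ne_of_mem_erase hl).symm
      linarith
    refine (Finset.sum_le_sum fun k _ => h2 k).trans (le_of_eq ?_)
    simp
  simp_rw [hrew, norm_smul, mul_pow]
  rw [← Finset.mul_sum, Real.norm_of_nonneg (by positivity)]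
  generalize ∑ i, ‖y i‖ ^ 2 = A at hmain hyz
  generalize ∑ i, ‖z i‖ ^ 2 = A' at hyz
  clear_value c
  clear hc
  calc (1 / (b : ℝ)) ^ 2 * ∑ I ∈ B, ‖∑ k, y (I k)‖ ^ 2
      ≤ (1 / (b : ℝ)) ^ 2 * (b * (B.card * (1 / n * A))) :=
        mul_le_mul_of_nonneg_left hmain (by positivity)
    _ = B.card * (1 / b * (1 / n * A)) := by field_simp
    _ ≤ _ := by gcongr

theorem Sampling.delta_nonneg (r : Sampling) : 0 ≤ r.delta n b := by
  cases r <;> simp only [Sampling.delta]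
  · norm_num
  · split_ifs <;> norm_num

theorem Sampling.delta_le_one (r : Sampling) : r.delta n b ≤ 1 := by
  cases r <;> simp only [Sampling.delta]
  · norm_num
  · split_ifs <;> norm_num

theorem Sampling.sum_sq_norm_batch_sub_mean_le (r : Sampling) {B : Finset (Fin b → Fin n)}
    (hBr : (B : Set (Fin b → Fin n)) = r.batches n b) (hn : 0 < n) (hb : 0 < b) (z : Fin n → V) :
    ∑ I ∈ B, ‖(1 / (b : ℝ)) • ∑ k, z (I k) - (1 / (n : ℝ)) • ∑ i, z i‖ ^ 2
      ≤ B.card * (r.delta n b / b * (1 / n * ∑ i, ‖z i‖ ^ 2)) := by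
  have hmem : ∀ I, I ∈ B ↔ I ∈ r.batches n b := fun I => by rw [← hBr]; rfl
  cases r with
  | withReplacement =>
    have hBu : B = Finset.univ := Finset.eq_univ_iff_forall.2 fun I => (hmem I).2 trivial
    subst hBu
    exact ZOProxSVRG.sum_sq_norm_batch_sub_mean_le hn hb (fun _ _ _ => Finset.mem_univ _)
      (fun y hy k l hkl => (sum_univ_inner_eq_zero hy hkl).le) z
  | withoutReplacement =>
    have hinj : ∀ I ∈ B, Function.Injective I := fun I hI => (hmem I).1 hI
    by_cases hbn : b < n
    · simp only [Sampling.delta, if_pos hbn]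
      have hB : ∀ (π : Equiv.Perm (Fin n)) I, I ∈ B → ⇑π ∘ I ∈ B := fun π I hI =>
        (hmem _).2 (π.injective.comp (hinj I hI))
      exact ZOProxSVRG.sum_sq_norm_batch_sub_mean_le hn hb hB
        (fun y hy k l hkl => sum_inner_nonpos_of_injective hB hinj hy hkl) z
    · simp only [Sampling.delta, if_neg hbn, zero_div, zero_mul, mul_zero]
      -- An injective tuple with b ≥ n lists every index exactly once, so its mean is the full mean.
      refine Finset.sum_nonpos fun I hI => ?_
      have hle : b ≤ n := by simpa using Fintype.card_le_of_injective I (hinj I hI)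
      have hbn' : b = n := by omega
      subst hbn'
      have : ∑ k, z (I k) = ∑ i, z i :=
        (Finite.injective_iff_bijective.1 (hinj I hI)).sum_comp z
      rw [this]
      simp

theorem integral_uniformOn_eq_sum (B : Finset (Fin b → Fin n)) (f : (Fin b → Fin n) → ℝ) :
    ∫ I, f I ∂uniformOn (B : Set (Fin b → Fin n)) = (B.card : ℝ)⁻¹ * ∑ I ∈ B, f I := by
  rw [uniformOn, ProbabilityTheory.cond, integral_smul_measure, setIntegral_finset _ Integrable.of_finite.integrableOn]
  simp [Measure.count_apply_finset]

theorem Sampling.integral_sq_norm_batch_sub_mean_le (r : Sampling) (hn : 0 < n) (hb : 0 < b)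
    (z : Fin n → V) :
    ∫ I : Fin b → Fin n, ‖(1 / (b : ℝ)) • ∑ k, z (I k) - (1 / (n : ℝ)) • ∑ i, z i‖ ^ 2
        ∂uniformOn (r.batches n b)
      ≤ r.delta n b / b * (1 / n * ∑ i, ‖z i‖ ^ 2) := by
  classical
  have hBr : (((r.batches n b).toFinite.toFinset : Finset _) : Set (Fin b → Fin n))
    = r.batches n b := Set.Finite.coe_toFinset _
  have h := r.sum_sq_norm_batch_sub_mean_le hBr hn hb z
  rw [← hBr, integral_uniformOn_eq_sum]
  set B := (r.batches n b).toFinite.toFinset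
  have h0 : 0 ≤ r.delta n b / b * (1 / n * ∑ i, ‖z i‖ ^ 2) := by
    have := r.delta_nonneg (n := n) (b := b)
    positivity
  -- There may be no admissible tuple at all (no repetition, b > n); the integral is then zero.
  rcases Nat.eq_zero_or_pos B.card with hc | hc
  · simpa [hc] using h0
  · rwa [inv_mul_le_iff₀ (by exact_mod_cast hc)]

end Batch

/-! ### Independence tools -/

section Independence

variable {Ω : Type*} [MeasurableSpace Ω] {P : Measure Ω}

theorem IndepFun.prodMk_assoc {α β γ : Type*} [MeasurableSpace α] [MeasurableSpace β]
    [MeasurableSpace γ] [IsProbabilityMeasure P] {A : Ω → α} {B : Ω → β} {C : Ω → γ}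
    (hA : Measurable A) (hB : Measurable B) (hC : Measurable C) (hAB : IndepFun A B P)
    (hABC : IndepFun (fun ω => (A ω, B ω)) C P) : IndepFun A (fun ω => (B ω, C ω)) P := by
  have hBC : IndepFun B C P := hABC.comp measurable_snd measurable_id
  have h1 := (indepFun_iff_map_prod_eq_prod_map_map hA.aemeasurable hB.aemeasurable).1 hAB
  have h2 := (indepFun_iff_map_prod_eq_prod_map_map hB.aemeasurable hC.aemeasurable).1 hBC
  have h3 := (indepFun_iff_map_prod_eq_prod_map_map (hA.prodMk hB).aemeasurable
    hC.aemeasurable).1 hABC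
  have := Measure.isProbabilityMeasure_map (μ := P) hA.aemeasurable
  have := Measure.isProbabilityMeasure_map (μ := P) hB.aemeasurable
  have := Measure.isProbabilityMeasure_map (μ := P) hC.aemeasurable
  refine (indepFun_iff_map_prod_eq_prod_map_map hA.aemeasurable
    (hB.prodMk hC).aemeasurable).2 ?_
  rw [h2, ← (measurePreserving_prodAssoc (P.map A) (P.map B) (P.map C)).map_eq, ← h1, ← h3,
    Measure.map_map (by fun_prop) (by fun_prop)]
  rfl

/-- Once coordinate q is made constant, the family is measurable with respect to the σ-algebra of
the other coordinates. -/
theorem iIndepFun.indepFun_update {ι α : Type*} [DecidableEq ι] [MeasurableSpace α]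
    {f : ι → Ω → α} (hf : iIndepFun f P) (hm : ∀ i, Measurable (f i)) (q : ι) (c : α) :
    IndepFun (f q) (fun ω => Function.update (fun i => f i ω) q c) P := by
  have h := indep_iSup_of_disjoint (fun i => (hm i).comap_le) hf.iIndep
    (disjoint_compl_right (a := ({q} : Set ι)))
  have hle : MeasurableSpace.comap (fun ω => Function.update (fun i => f i ω) q c) inferInstance
      ≤ ⨆ i ∈ ({q} : Set ι)ᶜ, MeasurableSpace.comap (f i) inferInstance := by
    rw [← measurable_iff_comap_le]
    refine (@measurable_pi_iff Ω ι (fun _ => α) (⨆ i ∈ ({q} : Set ι)ᶜ,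
      MeasurableSpace.comap (f i) inferInstance) _ _).2 fun i => ?_
    by_cases hi : i = q
    · subst hi
      simp only [Function.update_self]
      exact measurable_const
    · simp only [Function.update_of_ne hi]
      rw [measurable_iff_comap_le]
      exact le_iSup₂_of_le i hi le_rfl
  rw [iSup_singleton] at h
  exact indep_of_indep_of_le_right h hle

/-- Fubini for the product law of (X, Y): X is frozen and Y integrated out, which takes the place of
conditional expectation. -/
theorem integral_comp_le_of_indepFun [IsProbabilityMeasure P] {α β : Type*} [MeasurableSpace α]
    [MeasurableSpace β] {X : Ω → α} {Y : Ω → β} (hX : Measurable X) (hY : Measurable Y)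
    (hXY : IndepFun X Y P) {h : α × β → ℝ} (hm : Measurable h)
    (hi : Integrable (fun ω => h (X ω, Y ω)) P) {g : α → ℝ} (gm : Measurable g)
    (gi : Integrable (fun ω => g (X ω)) P) (hg : ∀ a, ∫ y, h (a, y) ∂(P.map Y) ≤ g a) :
    ∫ ω, h (X ω, Y ω) ∂P ≤ ∫ ω, g (X ω) ∂P := by
  have hmap := (indepFun_iff_map_prod_eq_prod_map_map hX.aemeasurable hY.aemeasurable).1 hXY
  have := Measure.isProbabilityMeasure_map (μ := P) hX.aemeasurable
  have := Measure.isProbabilityMeasure_map (μ := P) hY.aemeasurable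
  have hi' : Integrable h ((P.map X).prod (P.map Y)) := by
    rw [← hmap]
    exact (integrable_map_measure hm.aestronglyMeasurable (hX.prodMk hY).aemeasurable).2 hi
  have gi' : Integrable g (P.map X) :=
    (integrable_map_measure gm.aestronglyMeasurable hX.aemeasurable).2 gi
  have e1 : ∫ ω, h (X ω, Y ω) ∂P = ∫ z, h z ∂((P.map X).prod (P.map Y)) := by
    rw [← hmap, integral_map (hX.prodMk hY).aemeasurable hm.aestronglyMeasurable]
  rw [e1, integral_prod _ hi', ← integral_map hX.aemeasurable gm.aestronglyMeasurable]
  exact integral_mono hi'.integral_prod_left gi' hg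

end Independence

/-! ### Which randomness the iterates read, and their measurability -/

section Iterates

variable {d n b : ℕ}

/-- The ranges differ by one: x_t is determined by directions 0, …, t, number 0 being the
snapshot's, but by mini-batches 0, …, t - 1. -/
theorem inner_congr (p : Problem d n) (η μ : ℝ) {τ τ' : Tape d n b} {s : ℕ} (xs : E d) {t : ℕ}
    (hd : ∀ k ≤ t, τ.dir s k = τ'.dir s k) (hb : ∀ k < t, τ.batch s k = τ'.batch s k) :
    inner p η μ τ s xs t = inner p η μ τ' s xs t := by
  induction t with
  | zero => rfl
  | succ t ih =>
    have := ih (fun k hk => hd k (by omega)) (fun k hk => hb k (by omega))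
    simp only [inner, this, hd 0 (by omega), hd (t + 1) le_rfl, hb t (by omega)]

theorem snapshot_congr (p : Problem d n) (η μ : ℝ) (m : ℕ) {τ τ' : Tape d n b} {s : ℕ}
    (hi : τ.init = τ'.init) (hd : ∀ r < s, τ.dir r = τ'.dir r)
    (hb : ∀ r < s, τ.batch r = τ'.batch r) :
    snapshot p η μ m τ s = snapshot p η μ m τ' s := by
  induction s with
  | zero => exact hi
  | succ s ih =>
    simp only [snapshot]
    rw [ih (fun r hr => hd r (by omega)) (fun r hr => hb r (by omega))]
    exact inner_congr p η μ _ (fun k _ => by rw [hd s (by omega)])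
      (fun k _ => by rw [hb s (by omega)])

theorem iterate_congr (p : Problem d n) (η μ : ℝ) (m : ℕ) {τ τ' : Tape d n b} {s t : ℕ}
    (hi : τ.init = τ'.init) (hd : ∀ r < s, τ.dir r = τ'.dir r)
    (hb : ∀ r < s, τ.batch r = τ'.batch r)
    (hds : ∀ k ≤ t, τ.dir s k = τ'.dir s k) (hbs : ∀ k < t, τ.batch s k = τ'.batch s k) :
    iterate p η μ m τ s t = iterate p η μ m τ' s t := by
  rw [iterate, iterate, snapshot_congr p η μ m hi hd hb]
  exact inner_congr p η μ _ hds hbs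

variable {p : Problem d n} {L σ η μ : ℝ}

theorem measurable_mixture (hp : p.Regular L σ) {α : Type*} [MeasurableSpace α]
    {x xs : α → E d} {u w : Fin n → α → E d} {I : α → Fin b → Fin n} (hx : Measurable x)
    (hxs : Measurable xs) (hu : ∀ i, Measurable (u i)) (hw : ∀ i, Measurable (w i))
    (hI : Measurable I) :
    Measurable fun a =>
      mixture p μ (xs a) (fun i => w i a) (I a) (fun i => u i a) (x a) := by
  have hg : ∀ {y : α → E d} {v : Fin n → α → E d} (_ : Measurable y) (_ : ∀ i, Measurable (v i))
      (i : Fin n), Measurable fun a => gauSGE μ (p.comp i) (y a) (v i a) := by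
    intro y v hy hv i
    have hc : Continuous (p.comp i) := (hp.differentiable i).continuous
    exact measurable_gauSGE hc hy (hv i)
  have hbatch : ∀ {y : α → E d} {v : Fin n → α → E d} (_ : Measurable y)
      (_ : ∀ i, Measurable (v i)),
      Measurable fun a => batchEstimate p μ (I a) (fun i => v i a) (y a) := by
    intro y v hy hv
    have hs : Measurable fun a => ∑ k, gauSGE μ (p.comp (I a k)) (y a) (v (I a k) a) := by
      -- The summand has a random index; joint measurability in the point and the index is immediate
      -- because indices are countable.
      have hk : Measurable fun z : α × Fin n => gauSGE μ (p.comp z.2) (y z.1) (v z.2 z.1) :=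
        measurable_from_prod_countable_left fun i => hg hy hv i
      refine Finset.measurable_fun_sum _ fun k _ => ?_
      exact hk.comp (measurable_id.prodMk ((measurable_pi_apply k).comp hI))
    change Measurable fun a => (1 / (b : ℝ)) • ∑ k, gauSGE μ (p.comp (I a k)) (y a) (v (I a k) a)
    fun_prop
  unfold mixture
  refine ((hbatch hx hu).sub (hbatch hxs hw)).add ?_
  have hs : Measurable fun a => ∑ i, gauSGE μ (p.comp i) (xs a) (w i a) :=
    Finset.measurable_fun_sum _ fun i _ => hg hxs hw i
  exact hs.const_smul (1 / (n : ℝ))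

theorem measurable_inner (hp : p.Regular L σ) (hη : 0 < η) {α : Type*} [MeasurableSpace α]
    {τ : α → Tape d n b} {xs : α → E d} (hxs : Measurable xs)
    (hd : ∀ s k i, Measurable fun a => (τ a).dir s k i)
    (hb : ∀ s t, Measurable fun a => (τ a).batch s t) (s t : ℕ) :
    Measurable fun a => inner p η μ (τ a) s (xs a) t := by
  induction t with
  | zero => exact hxs
  | succ t ih =>
    simp only [inner]
    exact (continuous_prox hp.convex hη).measurable.comp (ih.sub
      ((measurable_mixture hp ih hxs (hd s (t + 1)) (hd s 0) (hb s t)).const_smul η))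

theorem measurable_snapshot (hp : p.Regular L σ) (hη : 0 < η) (m : ℕ) {α : Type*}
    [MeasurableSpace α] {τ : α → Tape d n b} (hi : Measurable fun a => (τ a).init)
    (hd : ∀ s k i, Measurable fun a => (τ a).dir s k i)
    (hb : ∀ s t, Measurable fun a => (τ a).batch s t) (s : ℕ) :
    Measurable fun a => snapshot p η μ m (τ a) s := by
  induction s with
  | zero => exact hi
  | succ s ih => exact measurable_inner hp hη ih hd hb s m

theorem measurable_iterate (hp : p.Regular L σ) (hη : 0 < η) (m : ℕ) {α : Type*}
    [MeasurableSpace α] {τ : α → Tape d n b} (hi : Measurable fun a => (τ a).init)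
    (hd : ∀ s k i, Measurable fun a => (τ a).dir s k i)
    (hb : ∀ s t, Measurable fun a => (τ a).batch s t) (s t : ℕ) :
    Measurable fun a => iterate p η μ m (τ a) s t :=
  measurable_inner hp hη (measurable_snapshot hp hη m hi hd hb s) hd hb s t

end Iterates

/-! ### Independence of the iterates from fresh randomness -/

section Masks

variable {d n b : ℕ}

/-- The tape with the direction of index `q` erased. -/
def Tape.eraseDir (τ : Tape d n b) (q : ℕ × ℕ × Fin n) : Tape d n b where
  init := τ.init
  dir s k i := Function.update (fun q : ℕ × ℕ × Fin n => τ.dir q.1 q.2.1 q.2.2) q 0 (s, k, i)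
  batch := τ.batch

/-- The tape with the mini-batch of index `q` replaced by `I`. -/
def Tape.replaceBatch (τ : Tape d n b) (q : ℕ × ℕ) (I : Fin b → Fin n) : Tape d n b where
  init := τ.init
  dir := τ.dir
  batch s t := Function.update (fun q : ℕ × ℕ => τ.batch q.1 q.2) q I (s, t)

theorem Tape.eraseDir_dir_of_ne (τ : Tape d n b) {q : ℕ × ℕ × Fin n} {s k : ℕ}
    (h : ¬ (s = q.1 ∧ k = q.2.1)) : (τ.eraseDir q).dir s k = τ.dir s k := by
  funext i
  simp only [Tape.eraseDir]
  rw [Function.update_of_ne]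
  rintro rfl
  exact h ⟨rfl, rfl⟩

theorem Tape.replaceBatch_batch_of_ne (τ : Tape d n b) {q : ℕ × ℕ} {I : Fin b → Fin n} {s t : ℕ}
    (h : ¬ (s = q.1 ∧ t = q.2)) : (τ.replaceBatch q I).batch s t = τ.batch s t := by
  simp only [Tape.replaceBatch]
  rw [Function.update_of_ne]
  rintro rfl
  exact h ⟨rfl, rfl⟩

theorem iterate_eraseDir (p : Problem d n) (η μ : ℝ) (m : ℕ) (τ : Tape d n b) {s t k : ℕ}
    (i : Fin n) (h : t < k) :
    iterate p η μ m (τ.eraseDir (s, k, i)) s t = iterate p η μ m τ s t :=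
  iterate_congr p η μ m rfl
    (fun _ hr => funext fun _ => τ.eraseDir_dir_of_ne fun h' => hr.ne h'.1) (fun _ _ => rfl)
    (fun _ hj => τ.eraseDir_dir_of_ne fun h' => (hj.trans_lt h).ne h'.2) (fun _ _ => rfl)

theorem snapshot_eraseDir (p : Problem d n) (η μ : ℝ) (m : ℕ) (τ : Tape d n b) (s k : ℕ)
    (i : Fin n) : snapshot p η μ m (τ.eraseDir (s, k, i)) s = snapshot p η μ m τ s :=
  snapshot_congr p η μ m rfl
    (fun _ hr => funext fun _ => τ.eraseDir_dir_of_ne fun h' => hr.ne h'.1) (fun _ _ => rfl)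

theorem iterate_replaceBatch (p : Problem d n) (η μ : ℝ) (m : ℕ) (τ : Tape d n b) (s t : ℕ)
    (I : Fin b → Fin n) :
    iterate p η μ m (τ.replaceBatch (s, t) I) s t = iterate p η μ m τ s t :=
  iterate_congr p η μ m rfl (fun _ _ => rfl)
    (fun _ hr => funext fun _ => τ.replaceBatch_batch_of_ne fun h' => hr.ne h'.1)
    (fun _ _ => rfl) (fun _ hj => τ.replaceBatch_batch_of_ne fun h' => hj.ne h'.2)

theorem snapshot_replaceBatch (p : Problem d n) (η μ : ℝ) (m : ℕ) (τ : Tape d n b) (s t : ℕ)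
    (I : Fin b → Fin n) :
    snapshot p η μ m (τ.replaceBatch (s, t) I) s = snapshot p η μ m τ s :=
  snapshot_congr p η μ m rfl (fun _ _ => rfl)
    (fun _ hr => funext fun _ => τ.replaceBatch_batch_of_ne fun h' => hr.ne h'.1)

namespace IsDraw

variable {Ω : Type u} [MeasurableSpace Ω] {P : Measure Ω} [IsProbabilityMeasure P]
  {r : Sampling} {τ : Ω → Tape d n b}

/-- A quantity that does not read direction q has the same value on the erased tape, so this makes
it independent of that direction. The other directions, the starting point and the mini-batches are
adjoined in turn by `IndepFun.prodMk_assoc`. -/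
theorem indepFun_dir_eraseDir (h : IsDraw r P τ) (q : ℕ × ℕ × Fin n) {β : Type*}
    [MeasurableSpace β] {φ : Tape d n b → β}
    (hφ : Measurable fun y : (E d × (ℕ → ℕ → Fin n → E d)) × (ℕ → ℕ → Fin b → Fin n) =>
      φ ⟨y.1.1, y.1.2, y.2⟩) :
    IndepFun (fun ω => φ ((τ ω).eraseDir q)) (fun ω => (τ ω).dir q.1 q.2.1 q.2.2) P := by
  have hdir : Measurable fun ω => (τ ω).dir := by
    refine measurable_pi_iff.2 fun s => measurable_pi_iff.2 fun k => measurable_pi_iff.2 fun i => ?_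
    exact h.measurable_dir s k i
  have hbatch : Measurable fun ω => (τ ω).batch :=
    measurable_pi_iff.2 fun s => measurable_pi_iff.2 fun t => h.measurable_batch s t
  set D : Ω → E d := fun ω => (τ ω).dir q.1 q.2.1 q.2.2 with hD
  set R : Ω → ℕ → ℕ → Fin n → E d := fun ω => ((τ ω).eraseDir q).dir with hR
  have hDm : Measurable D := h.measurable_dir _ _ _
  have hupd : Measurable fun e : ℕ → ℕ → Fin n → E d => fun s k i =>
      Function.update (fun q : ℕ × ℕ × Fin n => e q.1 q.2.1 q.2.2) q 0 (s, k, i) := by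
    refine measurable_pi_iff.2 fun s => measurable_pi_iff.2 fun k => measurable_pi_iff.2 fun i => ?_
    by_cases hq : (s, k, i) = q
    · simp only [hq, Function.update_self]
      exact measurable_const
    · simp only [Function.update_of_ne hq]
      fun_prop
  have hRm : Measurable R := hupd.comp hdir
  have hDR : IndepFun D R P := by
    have h1 := iIndepFun.indepFun_update h.indep_dir
      (fun q => h.measurable_dir q.1 q.2.1 q.2.2) q 0
    have hcurry : Measurable fun (e : ℕ × ℕ × Fin n → E d) s k i => e (s, k, i) := by
      refine measurable_pi_iff.2 fun s => measurable_pi_iff.2 fun k =>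
        measurable_pi_iff.2 fun i => ?_
      fun_prop
    exact h1.comp measurable_id hcurry
  have hDRI : IndepFun D (fun ω => (R ω, (τ ω).init)) P := by
    refine IndepFun.prodMk_assoc hDm hRm h.measurable_init hDR ?_
    refine h.indep_init_dir.symm.comp (φ := fun e : ℕ → ℕ → Fin n → E d => (e q.1 q.2.1 q.2.2,
      fun s k i => Function.update (fun q : ℕ × ℕ × Fin n => e q.1 q.2.1 q.2.2) q 0 (s, k, i)))
      (Measurable.prodMk ?_ hupd) measurable_id
    fun_prop
  have hall : IndepFun D (fun ω => ((R ω, (τ ω).init), (τ ω).batch)) P := by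
    refine IndepFun.prodMk_assoc hDm (hRm.prodMk h.measurable_init) hbatch hDRI ?_
    refine h.indep_batches.comp (φ := fun y : E d × (ℕ → ℕ → Fin n → E d) =>
      (y.2 q.1 q.2.1 q.2.2, (fun s k i =>
        Function.update (fun q : ℕ × ℕ × Fin n => y.2 q.1 q.2.1 q.2.2) q 0 (s, k, i), y.1)))
      (Measurable.prodMk ?_ ((hupd.comp measurable_snd).prodMk measurable_fst)) measurable_id
    fun_prop
  exact (hall.comp measurable_id (hφ.comp (f := fun y : ((ℕ → ℕ → Fin n → E d) × E d) ×
    (ℕ → ℕ → Fin b → Fin n) => ((y.1.2, y.1.1), y.2)) (by fun_prop))).symm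

theorem indepFun_batch_replaceBatch (h : IsDraw r P τ) (q : ℕ × ℕ) (I : Fin b → Fin n)
    {β : Type*} [MeasurableSpace β] {φ : Tape d n b → β}
    (hφ : Measurable fun y : (E d × (ℕ → ℕ → Fin n → E d)) × (ℕ → ℕ → Fin b → Fin n) =>
      φ ⟨y.1.1, y.1.2, y.2⟩) :
    IndepFun (fun ω => φ ((τ ω).replaceBatch q I)) (fun ω => (τ ω).batch q.1 q.2) P := by
  have hdir : Measurable fun ω => (τ ω).dir := by
    refine measurable_pi_iff.2 fun s => measurable_pi_iff.2 fun k => measurable_pi_iff.2 fun i => ?_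
    exact h.measurable_dir s k i
  set D : Ω → Fin b → Fin n := fun ω => (τ ω).batch q.1 q.2 with hD
  set R : Ω → ℕ → ℕ → Fin b → Fin n := fun ω => ((τ ω).replaceBatch q I).batch with hR
  have hDm : Measurable D := h.measurable_batch _ _
  have hupd : Measurable fun (e : ℕ → ℕ → Fin b → Fin n) s t =>
      Function.update (fun q : ℕ × ℕ => e q.1 q.2) q I (s, t) := by
    refine measurable_pi_iff.2 fun s => measurable_pi_iff.2 fun k => ?_
    by_cases hq : (s, k) = q
    · simp only [hq, Function.update_self]
      exact measurable_const
    · simp only [Function.update_of_ne hq]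
      fun_prop
  have hbatch : Measurable fun ω => (τ ω).batch :=
    measurable_pi_iff.2 fun s => measurable_pi_iff.2 fun t => h.measurable_batch s t
  have hRm : Measurable R := hupd.comp hbatch
  have hDR : IndepFun D R P := by
    have h1 := iIndepFun.indepFun_update h.indep_batch (fun q => h.measurable_batch q.1 q.2) q I
    have hcurry : Measurable fun (e : ℕ × ℕ → Fin b → Fin n) s t => e (s, t) :=
      measurable_pi_iff.2 fun s => measurable_pi_iff.2 fun t => measurable_pi_apply _
    exact h1.comp measurable_id hcurry
  have hall : IndepFun D (fun ω => (R ω, ((τ ω).init, (τ ω).dir))) P := by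
    refine IndepFun.prodMk_assoc hDm hRm (h.measurable_init.prodMk hdir) hDR ?_
    refine h.indep_batches.symm.comp (φ := fun e : ℕ → ℕ → Fin b → Fin n => (e q.1 q.2,
      fun s t => Function.update (fun q : ℕ × ℕ => e q.1 q.2) q I (s, t)))
      (Measurable.prodMk ?_ hupd) measurable_id
    exact (measurable_pi_apply q.2).comp (measurable_pi_apply q.1)
  exact (hall.comp measurable_id (hφ.comp (f := fun y : (ℕ → ℕ → Fin b → Fin n) ×
    (E d × (ℕ → ℕ → Fin n → E d)) => (y.2, y.1)) measurable_swap)).symm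

end IsDraw

end Masks

/-! ### The error of the mixture gradient at random points -/

section Variance

variable {d n b : ℕ} {p : Problem d n} {L σ μ : ℝ} {Ω : Type u} [MeasurableSpace Ω]
  {P : Measure Ω}

theorem memLp_gauSGE (hp : p.Regular L σ) (hμ : 0 < μ) (i : Fin n) {x u : Ω → E d}
    (hx : Measurable x) (hu : Measurable u) (hul : HasLaw u (stdGaussian (E d)) P) :
    MemLp (fun ω => gauSGE μ (p.comp i) (x ω) (u ω)) 2 P := by
  have hc : Continuous (p.comp i) := (hp.differentiable i).continuous
  have hm : Measurable fun ω => gauSGE μ (p.comp i) (x ω) (u ω) := measurable_gauSGE hc hx hu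
  have hu4 : Integrable (fun ω => ‖u ω‖ ^ 4) P := by
    have := integrable_norm_pow_stdGaussian (d := d) 4
    rw [← hul.map_eq] at this
    exact (integrable_map_measure (by fun_prop) hul.aemeasurable).1 this
  refine (memLp_two_iff_integrable_sq_norm hm.aestronglyMeasurable).2 ?_
  refine (hu4.const_mul (σ ^ 2)).mono' (hm.norm.pow_const 2).aestronglyMeasurable (Filter.Eventually.of_forall fun ω => ?_)
  rw [Real.norm_eq_abs, abs_pow, abs_norm]
  refine (pow_le_pow_left₀ (norm_nonneg _) (hp.norm_gauSGE_le hμ i (x ω) (u ω)) 2).trans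
    (le_of_eq ?_)
  rw [mul_pow, sq_abs]; ring

theorem memLp_batch_sub_mean {ζ : Fin n → Ω → E d} {I : Ω → Fin b → Fin n}
    (hζ : ∀ i, MemLp (ζ i) 2 P) (hζm : ∀ i, Measurable (ζ i)) (hI : Measurable I) :
    MemLp (fun ω => (1 / (b : ℝ)) • ∑ k, ζ (I ω k) ω - (1 / (n : ℝ)) • ∑ i, ζ i ω) 2 P := by
  have h2 : MemLp (fun ω => ∑ i, ζ i ω) 2 P := memLp_finsetSum _ fun i _ => hζ i
  suffices h1 : MemLp (fun ω => ∑ k, ζ (I ω k) ω) 2 P from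
    (h1.const_smul (1 / (b : ℝ))).sub (h2.const_smul (1 / (n : ℝ)))
  refine memLp_finsetSum _ fun k _ => ?_
  -- A randomly selected term is dominated by the sum of the norms of all terms.
  have hsum : MemLp (fun ω => ∑ i, ‖ζ i ω‖) 2 P := memLp_finsetSum _ fun i _ => (hζ i).norm
  have hm : Measurable fun ω => ζ (I ω k) ω := by
    have hk : Measurable fun z : Ω × Fin n => ζ z.2 z.1 :=
      measurable_from_prod_countable_left fun i => hζm i
    exact hk.comp (measurable_id.prodMk ((measurable_pi_apply k).comp hI))
  refine hsum.mono hm.aestronglyMeasurable (Filter.Eventually.of_forall fun ω => ?_)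
  rw [Real.norm_of_nonneg (Finset.sum_nonneg fun i _ => norm_nonneg _)]
  exact Finset.single_le_sum (f := fun i => ‖ζ i ω‖) (fun i _ => norm_nonneg _)
    (Finset.mem_univ (I ω k))

variable [IsProbabilityMeasure P]

theorem integral_le_of_indepFun_gaussian {x u : Ω → E d} (hx : Measurable x) (hu : Measurable u)
    (hul : HasLaw u (stdGaussian (E d)) P) (hxu : IndepFun x u P) {h : E d × E d → ℝ}
    (hm : Measurable h) (hi : Integrable (fun ω => h (x ω, u ω)) P) {c : ℝ}
    (hc : ∀ y, ∫ v, h (y, v) ∂stdGaussian (E d) ≤ c) : ∫ ω, h (x ω, u ω) ∂P ≤ c := by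
  have := integral_comp_le_of_indepFun hx hu hxu hm hi (g := fun _ => c) measurable_const
    (integrable_const _) (by rwa [hul.map_eq])
  simpa using this

theorem integral_sq_norm_gauSGE_le (hp : p.Regular L σ) (hμ : 0 < μ) (i : Fin n) {x u : Ω → E d}
    (hx : Measurable x) (hu : Measurable u) (hul : HasLaw u (stdGaussian (E d)) P)
    (hxu : IndepFun x u P) :
    ∫ ω, ‖gauSGE μ (p.comp i) (x ω) (u ω)‖ ^ 2 ∂P
      ≤ 2 * (d + 2) * σ ^ 2 + L ^ 2 * μ ^ 2 / 2 * (d * (d + 2) * (d + 4)) := by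
  have hc : Continuous (p.comp i) := (hp.differentiable i).continuous
  exact integral_le_of_indepFun_gaussian hx hu hul hxu
    (h := fun z => ‖gauSGE μ (p.comp i) z.1 z.2‖ ^ 2)
    ((measurable_gauSGE hc measurable_fst measurable_snd).norm.pow_const 2)
    (memLp_gauSGE hp hμ i hx hu hul).integrable_norm_pow'
    (fun y => hp.integral_sq_gauSGE_le hμ i y)

theorem memLp_gauSGE_sub_gradient (hp : p.Regular L σ) (hμ : 0 < μ) (i : Fin n) {x u : Ω → E d}
    (hx : Measurable x) (hu : Measurable u) (hul : HasLaw u (stdGaussian (E d)) P) :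
    MemLp (fun ω => gauSGE μ (p.comp i) (x ω) (u ω) - gradient (p.comp i) (x ω)) 2 P := by
  refine (memLp_gauSGE hp hμ i hx hu hul).sub (MemLp.of_bound ?_ |σ| ?_)
  · exact ((hp.continuous_gradient i).measurable.comp hx).aestronglyMeasurable
  · exact Filter.Eventually.of_forall fun ω => hp.norm_gradient_le i (x ω)

theorem integral_sq_norm_gauSGE_sub_gradient_le (hp : p.Regular L σ) (hμ : 0 < μ) (i : Fin n)
    {x u : Ω → E d} (hx : Measurable x) (hu : Measurable u)
    (hul : HasLaw u (stdGaussian (E d)) P) (hxu : IndepFun x u P) :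
    ∫ ω, ‖gauSGE μ (p.comp i) (x ω) (u ω) - gradient (p.comp i) (x ω)‖ ^ 2 ∂P
      ≤ 2 * (d + 1) * σ ^ 2 + L ^ 2 * μ ^ 2 / 2 * (d * (d + 2) * (d + 4)) := by
  have hc : Continuous (p.comp i) := (hp.differentiable i).continuous
  exact integral_le_of_indepFun_gaussian hx hu hul hxu
    (h := fun z => ‖gauSGE μ (p.comp i) z.1 z.2 - gradient (p.comp i) z.1‖ ^ 2)
    (((measurable_gauSGE hc measurable_fst measurable_snd).sub
      ((hp.continuous_gradient i).measurable.comp measurable_fst)).norm.pow_const 2)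
    (memLp_gauSGE_sub_gradient hp hμ i hx hu hul).integrable_norm_pow'
    (fun y => hp.integral_sq_gauSGE_sub_gradient_le hμ i y)

theorem integral_sq_norm_sub_le {y z : Ω → E d} (hy : MemLp y 2 P) (hz : MemLp z 2 P) :
    ∫ ω, ‖y ω - z ω‖ ^ 2 ∂P ≤ 2 * ∫ ω, ‖y ω‖ ^ 2 ∂P + 2 * ∫ ω, ‖z ω‖ ^ 2 ∂P := by
  have iy := hy.integrable_norm_pow'
  have iz := hz.integrable_norm_pow'
  rw [← integral_const_mul, ← integral_const_mul,
    ← integral_add (iy.const_mul 2) (iz.const_mul 2)]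
  refine integral_mono (hy.sub hz).integrable_norm_pow' ((iy.const_mul 2).add (iz.const_mul 2))
    fun ω => ?_
  have := norm_add_sq_le_two_mul (y ω) (-z ω)
  rwa [norm_neg, ← sub_eq_add_neg] at this

/-- Convexity of the squared norm. Averaging over i this way requires no independence between the
directions of different components. -/
theorem sq_norm_mean_le {V : Type*} [SeminormedAddCommGroup V] [NormedSpace ℝ V]
    (v : Fin n → V) : ‖(1 / (n : ℝ)) • ∑ i, v i‖ ^ 2 ≤ 1 / n * ∑ i, ‖v i‖ ^ 2 := by
  rcases Nat.eq_zero_or_pos n with hn | hn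
  · subst hn; simp
  have hn' : (0 : ℝ) < n := by exact_mod_cast hn
  have h1 : ‖∑ i, v i‖ ^ 2 ≤ n * ∑ i, ‖v i‖ ^ 2 := by
    refine (pow_le_pow_left₀ (norm_nonneg _) (norm_sum_le _ _) 2).trans ?_
    simpa using sq_sum_le_card_mul_sum_sq (s := Finset.univ) (f := fun i => ‖v i‖)
  rw [norm_smul, mul_pow, Real.norm_of_nonneg (by positivity)]
  calc (1 / (n : ℝ)) ^ 2 * ‖∑ i, v i‖ ^ 2 ≤ (1 / (n : ℝ)) ^ 2 * (n * ∑ i, ‖v i‖ ^ 2) :=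
        mul_le_mul_of_nonneg_left h1 (by positivity)
    _ = _ := by field_simp

theorem mean_le_of_forall_le (hn : 0 < n) {v : Fin n → ℝ} {c : ℝ} (h : ∀ i, v i ≤ c) :
    1 / (n : ℝ) * ∑ i, v i ≤ c := by
  have hn' : (0 : ℝ) < n := by exact_mod_cast hn
  have := Finset.sum_le_sum (s := Finset.univ) fun i _ => h i
  simp only [Finset.sum_const, Finset.card_univ, Fintype.card_fin, nsmul_eq_mul] at this
  rwa [one_div, inv_mul_le_iff₀ hn']

theorem integral_sq_norm_batch_sub_mean_le {r : Sampling} (hn : 0 < n) (hb : 0 < b)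
    {ζ : Fin n → Ω → E d} {I : Ω → Fin b → Fin n}
    (hζ : ∀ i, MemLp (ζ i) 2 P) (hζm : ∀ i, Measurable (ζ i)) (hI : Measurable I)
    (hIl : HasLaw I (uniformOn (r.batches n b)) P) (hind : IndepFun (fun ω i => ζ i ω) I P) :
    ∫ ω, ‖(1 / (b : ℝ)) • ∑ k, ζ (I ω k) ω - (1 / (n : ℝ)) • ∑ i, ζ i ω‖ ^ 2 ∂P
      ≤ r.delta n b / b * (1 / n * ∑ i, ∫ ω, ‖ζ i ω‖ ^ 2 ∂P) := by
  have hint : Integrable (fun ω => r.delta n b / b * (1 / n * ∑ i, ‖ζ i ω‖ ^ 2)) P :=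
    ((integrable_finsetSum _ fun i _ => (hζ i).integrable_norm_pow').const_mul _).const_mul _
  have h := integral_comp_le_of_indepFun (measurable_pi_iff.2 hζm) hI hind
    (h := fun z : (Fin n → E d) × (Fin b → Fin n) =>
      ‖(1 / (b : ℝ)) • ∑ k, z.1 (z.2 k) - (1 / (n : ℝ)) • ∑ i, z.1 i‖ ^ 2)
    (measurable_from_prod_countable_left fun I => by fun_prop)
    (memLp_batch_sub_mean hζ hζm hI).integrable_norm_pow'
    (g := fun z => r.delta n b / b * (1 / n * ∑ i, ‖z i‖ ^ 2)) (by fun_prop) hint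
    (fun z => by rw [hIl.map_eq]; exact r.integral_sq_norm_batch_sub_mean_le hn hb z)
  refine h.trans (le_of_eq ?_)
  rw [integral_const_mul, integral_const_mul,
    integral_finsetSum _ fun i _ => (hζ i).integrable_norm_pow']

theorem mixture_sub_gradient_loss (hp : p.Regular L σ) (x xs : E d) (u w : Fin n → E d)
    (I : Fin b → Fin n) :
    mixture p μ xs w I u x - gradient p.loss x =
      ((1 / (b : ℝ)) • ∑ k, (gauSGE μ (p.comp (I k)) x (u (I k))
          - gauSGE μ (p.comp (I k)) xs (w (I k)))
        - (1 / (n : ℝ)) • ∑ i, (gauSGE μ (p.comp i) x (u i) - gauSGE μ (p.comp i) xs (w i)))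
      + (1 / (n : ℝ)) • ∑ i, (gauSGE μ (p.comp i) x (u i) - gradient (p.comp i) x) := by
  rw [hp.gradient_loss]
  simp only [mixture, batchEstimate, fullEstimate, Finset.sum_sub_distrib, smul_sub]
  abel

/-- The point x may depend on the snapshot directions w, so only the pairs (x, u_i) and (x̃, w_i)
are independent. Each ζ_i is therefore bounded through its two halves separately, which costs the 4
in 4V. -/
theorem mixture_error (hp : p.Regular L σ) (hμ : 0 < μ) (hn : 0 < n) (hb : 0 < b) {r : Sampling}
    {x xs : Ω → E d} {u w : Fin n → Ω → E d} {I : Ω → Fin b → Fin n}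
    (hx : Measurable x) (hxs : Measurable xs) (hu : ∀ i, Measurable (u i))
    (hw : ∀ i, Measurable (w i)) (hI : Measurable I)
    (hul : ∀ i, HasLaw (u i) (stdGaussian (E d)) P) (hwl : ∀ i, HasLaw (w i) (stdGaussian (E d)) P)
    (hIl : HasLaw I (uniformOn (r.batches n b)) P)
    (hxu : ∀ i, IndepFun x (u i) P) (hxw : ∀ i, IndepFun xs (w i) P)
    (hind : IndepFun (fun ω => (x ω, xs ω, (fun i => u i ω), (fun i => w i ω))) I P) :
    Integrable (fun ω => ‖mixture p μ (xs ω) (fun i => w i ω) (I ω) (fun i => u i ω) (x ω)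
      - gradient p.loss (x ω)‖ ^ 2) P ∧
    ∫ ω, ‖mixture p μ (xs ω) (fun i => w i ω) (I ω) (fun i => u i ω) (x ω)
      - gradient p.loss (x ω)‖ ^ 2 ∂P
      ≤ (2 + 12 * r.delta n b / b) * ((d + 6) ^ 3 * (L ^ 2 * μ ^ 2))
        + (4 + 24 * r.delta n b / b) * ((2 * d + 9) * σ ^ 2) := by
  set ζ : Fin n → Ω → E d := fun i ω => gauSGE μ (p.comp i) (x ω) (u i ω)
    - gauSGE μ (p.comp i) (xs ω) (w i ω) with hζdef
  set ξ : Fin n → Ω → E d := fun i ω => gauSGE μ (p.comp i) (x ω) (u i ω)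
    - gradient (p.comp i) (x ω) with hξdef
  have ha := fun i => memLp_gauSGE hp hμ i hx (hu i) (hul i)
  have ha' := fun i => memLp_gauSGE hp hμ i hxs (hw i) (hwl i)
  have hζ : ∀ i, MemLp (ζ i) 2 P := fun i => (ha i).sub (ha' i)
  have hξ : ∀ i, MemLp (ξ i) 2 P := fun i => memLp_gauSGE_sub_gradient hp hμ i hx (hu i) (hul i)
  have hcont : ∀ i, Continuous (p.comp i) := fun i => (hp.differentiable i).continuous
  have hζm : ∀ i, Measurable (ζ i) := fun i =>
    (measurable_gauSGE (hcont i) hx (hu i)).sub (measurable_gauSGE (hcont i) hxs (hw i))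
  have hζI : IndepFun (fun ω i => ζ i ω) I P := by
    refine hind.comp (φ := fun z : E d × E d × (Fin n → E d) × (Fin n → E d) => fun i =>
      gauSGE μ (p.comp i) z.1 (z.2.2.1 i) - gauSGE μ (p.comp i) z.2.1 (z.2.2.2 i))
      (measurable_pi_iff.2 fun i => ?_) measurable_id
    exact (measurable_gauSGE (hcont i) (by fun_prop) (by fun_prop)).sub
      (measurable_gauSGE (hcont i) (by fun_prop) (by fun_prop))
  set V : ℝ := 2 * (d + 2) * σ ^ 2 + L ^ 2 * μ ^ 2 / 2 * (d * (d + 2) * (d + 4)) with hV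
  set W : ℝ := 2 * (d + 1) * σ ^ 2 + L ^ 2 * μ ^ 2 / 2 * (d * (d + 2) * (d + 4)) with hW
  have hζV : 1 / (n : ℝ) * ∑ i, ∫ ω, ‖ζ i ω‖ ^ 2 ∂P ≤ 4 * V := mean_le_of_forall_le hn fun i => by
    have h1 := integral_sq_norm_sub_le (ha i) (ha' i)
    have h2 := integral_sq_norm_gauSGE_le hp hμ i hx (hu i) (hul i) (hxu i)
    have h3 := integral_sq_norm_gauSGE_le hp hμ i hxs (hw i) (hwl i) (hxw i)
    linarith
  have hξW : 1 / (n : ℝ) * ∑ i, ∫ ω, ‖ξ i ω‖ ^ 2 ∂P ≤ W := mean_le_of_forall_le hn fun i =>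
    integral_sq_norm_gauSGE_sub_gradient_le hp hμ i hx (hu i) (hul i) (hxu i)
  have hN1 := memLp_batch_sub_mean hζ hζm hI
  have hN1' := integral_sq_norm_batch_sub_mean_le hn hb hζ hζm hI hIl hζI
  have hN2 : MemLp (fun ω => (1 / (n : ℝ)) • ∑ i, ξ i ω) 2 P := by
    have h2 : MemLp (fun ω => ∑ i, ξ i ω) 2 P := memLp_finsetSum _ fun i _ => hξ i
    exact h2.const_smul (1 / (n : ℝ))
  have hN2' : ∫ ω, ‖(1 / (n : ℝ)) • ∑ i, ξ i ω‖ ^ 2 ∂P ≤ W := by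
    refine (integral_mono hN2.integrable_norm_pow' ((integrable_finsetSum _ fun i _ =>
      (hξ i).integrable_norm_pow').const_mul _) fun ω => sq_norm_mean_le fun i => ξ i ω).trans ?_
    rw [integral_const_mul, integral_finsetSum _ fun i _ => (hξ i).integrable_norm_pow']
    exact hξW
  simp_rw [mixture_sub_gradient_loss hp]
  refine ⟨(hN1.add hN2).integrable_norm_pow', ?_⟩
  have h2 := integral_sq_norm_sub_le hN1 hN2.neg
  simp only [Pi.neg_apply, sub_neg_eq_add, norm_neg] at h2
  refine h2.trans ?_
  have hδ : 0 ≤ r.delta n b / b := div_nonneg r.delta_nonneg (Nat.cast_nonneg b)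
  have h3 : r.delta n b / b * (1 / n * ∑ i, ∫ ω, ‖ζ i ω‖ ^ 2 ∂P) ≤ r.delta n b / b * (4 * V) :=
    mul_le_mul_of_nonneg_left hζV hδ
  rw [mul_div_assoc, mul_div_assoc]
  set δ := r.delta n b / b
  -- With the outer factor 2, the coefficients 6 and 12 here become 12δ_n/b and 24δ_n/b, and those
  -- of `hWb` become 2 and 4.
  have hVb : 4 * V ≤ 6 * ((d + 6) ^ 3 * (L ^ 2 * μ ^ 2)) + 12 * ((2 * d + 9) * σ ^ 2) := by
    have hd : (0 : ℝ) ≤ d := Nat.cast_nonneg d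
    have e1 : (d : ℝ) * (d + 2) * (d + 4) ≤ (d + 6) ^ 3 := by nlinarith [sq_nonneg (d : ℝ)]
    have e2 := mul_le_mul_of_nonneg_right e1 (by positivity : 0 ≤ L ^ 2 * μ ^ 2)
    have e3 : 0 ≤ (d : ℝ) * (d + 2) * (d + 4) * (L ^ 2 * μ ^ 2) := by positivity
    have e4 := mul_nonneg hd (sq_nonneg σ)
    rw [hV]
    nlinarith [sq_nonneg σ]
  have hWb : W ≤ (d + 6) ^ 3 * (L ^ 2 * μ ^ 2) + 2 * ((2 * d + 9) * σ ^ 2) := by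
    have hd : (0 : ℝ) ≤ d := Nat.cast_nonneg d
    have e1 : (d : ℝ) * (d + 2) * (d + 4) ≤ (d + 6) ^ 3 := by nlinarith [sq_nonneg (d : ℝ)]
    have e2 := mul_le_mul_of_nonneg_right e1 (by positivity : 0 ≤ L ^ 2 * μ ^ 2)
    have e3 : 0 ≤ (d : ℝ) * (d + 2) * (d + 4) * (L ^ 2 * μ ^ 2) := by positivity
    have e4 := mul_nonneg hd (sq_nonneg σ)
    rw [hW]
    nlinarith [sq_nonneg σ]
  have hVδ := mul_le_mul_of_nonneg_left hVb hδ
  linarith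

end Variance

/-! ### Telescoping over epochs -/

/-- Passing from t = 0, …, m - 1 to t = 1, …, m changes each epoch's sum by G (s+1) 0 - G s 0, which
telescopes as well. `hlast` pays for the final term, and the value of X at the end cancels. -/
theorem sum_epochs_le {X G : ℕ → ℕ → ℝ} {γ c lo : ℝ} {m S : ℕ} (hγ : 0 ≤ γ)
    (hG : ∀ s t, 0 ≤ G s t) (hstep : ∀ s t, X s (t + 1) + γ * G s t ≤ X s t + c)
    (hX : ∀ s, X s m = X (s + 1) 0) (hGm : ∀ s, G s m = G (s + 1) 0)
    (hlast : γ * G S 0 ≤ X S 0 - lo) :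
    γ * ∑ s ∈ Finset.range S, ∑ t ∈ Finset.Icc 1 m, G s t ≤ X 0 0 - lo + ((m * S : ℕ) : ℝ) * c := by
  have hepoch : ∀ s k, X s k + γ * ∑ t ∈ Finset.range k, G s t ≤ X s 0 + k * c := by
    intro s k
    induction k with
    | zero => simp
    | succ k ih =>
      rw [Finset.sum_range_succ]
      push_cast
      linarith [hstep s k]
  have hshift : ∀ s, ∑ t ∈ Finset.Icc 1 m, G s t
      = ∑ t ∈ Finset.range m, G s t - G s 0 + G (s + 1) 0 := by
    intro s
    rw [← hGm s]
    clear * -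
    induction m with
    | zero => simp
    | succ m ih =>
      rw [Finset.sum_Icc_succ_top (by omega), Finset.sum_range_succ, ih]
      ring
  have hall : ∀ k, X k 0 + γ * ∑ s ∈ Finset.range k, ∑ t ∈ Finset.Icc 1 m, G s t
      ≤ X 0 0 + ((m * k : ℕ) : ℝ) * c + γ * (G k 0 - G 0 0) := by
    intro k
    induction k with
    | zero => simp
    | succ k ih =>
      rw [Finset.sum_range_succ, hshift k]
      have := hepoch k m
      rw [hX k] at this
      push_cast at ih ⊢
      linarith
  have h1 := hall S
  have h2 := mul_nonneg hγ (hG 0 0)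
  linarith

theorem iterate_succ {d n b : ℕ} (p : Problem d n) (η μ : ℝ) (m : ℕ) (τ : Tape d n b) (s t : ℕ) :
    iterate p η μ m τ s (t + 1) = prox η p.reg (iterate p η μ m τ s t -
      η • mixture p μ (snapshot p η μ m τ s) (τ.dir s 0) (τ.batch s t) (τ.dir s (t + 1))
        (iterate p η μ m τ s t)) := rfl

namespace IsDraw

variable {d n b : ℕ} {p : Problem d n} {L σ η μ : ℝ} {Ω : Type u} [MeasurableSpace Ω]
  {P : Measure Ω} {r : Sampling} {τ : Ω → Tape d n b}

theorem measurable_iterate (h : IsDraw r P τ) (hp : p.Regular L σ) (hη : 0 < η) (m s t : ℕ) :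
    Measurable fun ω => iterate p η μ m (τ ω) s t :=
  ZOProxSVRG.measurable_iterate hp hη m h.measurable_init h.measurable_dir h.measurable_batch s t

variable [IsProbabilityMeasure P]

/-- Neither x_t nor the snapshot changes when the direction about to be used on it is erased, nor
when mini-batch t is replaced. -/
theorem mixture_error (h : IsDraw r P τ) (hp : p.Regular L σ) (hη : 0 < η) (hμ : 0 < μ)
    (hn : 0 < n) (hb : 0 < b) (m s t : ℕ) :
    Integrable (fun ω => ‖mixture p μ (snapshot p η μ m (τ ω) s) ((τ ω).dir s 0) ((τ ω).batch s t)
      ((τ ω).dir s (t + 1)) (iterate p η μ m (τ ω) s t)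
      - gradient p.loss (iterate p η μ m (τ ω) s t)‖ ^ 2) P ∧
    ∫ ω, ‖mixture p μ (snapshot p η μ m (τ ω) s) ((τ ω).dir s 0) ((τ ω).batch s t)
      ((τ ω).dir s (t + 1)) (iterate p η μ m (τ ω) s t)
      - gradient p.loss (iterate p η μ m (τ ω) s t)‖ ^ 2 ∂P
      ≤ (2 + 12 * r.delta n b / b) * ((d + 6) ^ 3 * (L ^ 2 * μ ^ 2))
        + (4 + 24 * r.delta n b / b) * ((2 * d + 9) * σ ^ 2) := by
  have hdir : ∀ s k i, Measurable fun y : (E d × (ℕ → ℕ → Fin n → E d)) ×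
      (ℕ → ℕ → Fin b → Fin n) => y.1.2 s k i := fun s k i => by fun_prop
  have hbatch : ∀ s t, Measurable fun y : (E d × (ℕ → ℕ → Fin n → E d)) ×
      (ℕ → ℕ → Fin b → Fin n) => y.2 s t := fun s t =>
    (measurable_pi_apply t).comp ((measurable_pi_apply s).comp measurable_snd)
  have hit : Measurable fun y : (E d × (ℕ → ℕ → Fin n → E d)) × (ℕ → ℕ → Fin b → Fin n) =>
      iterate p η μ m (⟨y.1.1, y.1.2, y.2⟩ : Tape d n b) s t :=
    ZOProxSVRG.measurable_iterate hp hη m (by fun_prop) hdir hbatch s t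
  have hsn : Measurable fun y : (E d × (ℕ → ℕ → Fin n → E d)) × (ℕ → ℕ → Fin b → Fin n) =>
      snapshot p η μ m (⟨y.1.1, y.1.2, y.2⟩ : Tape d n b) s :=
    measurable_snapshot hp hη m (by fun_prop) hdir hbatch s
  refine ZOProxSVRG.mixture_error hp hμ hn hb (h.measurable_iterate hp hη m s t)
    (measurable_snapshot hp hη m h.measurable_init h.measurable_dir h.measurable_batch s)
    (h.measurable_dir s (t + 1)) (h.measurable_dir s 0) (h.measurable_batch s t)
    (h.law_dir s (t + 1)) (h.law_dir s 0) (h.law_batch s t) (fun i => ?_) (fun i => ?_) ?_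
  · have := h.indepFun_dir_eraseDir (s, t + 1, i) (φ := fun τ => iterate p η μ m τ s t) hit
    simpa only [iterate_eraseDir p η μ m _ i (Nat.lt_succ_self t)] using this
  · have := h.indepFun_dir_eraseDir (s, 0, i) (φ := fun τ => snapshot p η μ m τ s) hsn
    simpa only [snapshot_eraseDir] using this
  · have hφ : Measurable fun y : (E d × (ℕ → ℕ → Fin n → E d)) × (ℕ → ℕ → Fin b → Fin n) =>
        (iterate p η μ m (⟨y.1.1, y.1.2, y.2⟩ : Tape d n b) s t,
          snapshot p η μ m (⟨y.1.1, y.1.2, y.2⟩ : Tape d n b) s, y.1.2 s (t + 1), y.1.2 s 0) :=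
      hit.prodMk (hsn.prodMk (Measurable.prodMk (by fun_prop) (by fun_prop)))
    -- Any fixed tuple will do as a replacement; it need not be admissible for the sampling scheme.
    have := h.indepFun_batch_replaceBatch (s, t) (fun _ => ⟨0, hn⟩)
      (φ := fun τ => (iterate p η μ m τ s t, snapshot p η μ m τ s, τ.dir s (t + 1), τ.dir s 0)) hφ
    simp only [iterate_replaceBatch, snapshot_replaceBatch] at this
    exact this

/-- By induction: F(x_{t+1}) - F(x_*) is nonnegative and, by the descent inequality, at most F(x_t)
- F(x_*) plus an integrable error. -/
theorem integrable_obj_iterate (h : IsDraw r P τ) (hp : p.Regular L σ) (hη : 0 < η)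
    (hηL : η * L < 1 / 2) (hμ : 0 < μ) (hn : 0 < n) (hb : 0 < b) {xopt : E d}
    (ho : p.IsOptimal xopt) (h0 : Integrable (fun ω => p.obj (τ ω).init) P) (m s t : ℕ) :
    Integrable (fun ω => p.obj (iterate p η μ m (τ ω) s t)) P := by
  have hinner : ∀ s, Integrable (fun ω => p.obj (iterate p η μ m (τ ω) s 0)) P →
      ∀ t, Integrable (fun ω => p.obj (iterate p η μ m (τ ω) s t)) P := by
    intro s hs t
    induction t with
    | zero => exact hs
    | succ t ih =>
      have herr := (h.mixture_error hp hη hμ hn hb m s t).1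
      have hdom := (ih.sub (integrable_const (p.obj xopt))).add (herr.const_mul (η / 2))
      have hsub : Integrable (fun ω => p.obj (iterate p η μ m (τ ω) s (t + 1)) - p.obj xopt) P := by
        refine hdom.mono' ((hp.continuous_obj.measurable.comp
          (h.measurable_iterate hp hη m s (t + 1))).sub_const _).aestronglyMeasurable
          (Filter.Eventually.of_forall fun ω => ?_)
        rw [Real.norm_of_nonneg (sub_nonneg.2 (ho _))]
        have h1 := hp.obj_prox_add_sq_gradMap_le hn hη (by linarith) (iterate p η μ m (τ ω) s t)
          (mixture p μ (snapshot p η μ m (τ ω) s) ((τ ω).dir s 0) ((τ ω).batch s t)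
            ((τ ω).dir s (t + 1)) (iterate p η μ m (τ ω) s t))
        have h2 : 0 ≤ (η / 2 - η ^ 2 * L) * ‖gradMap p η (iterate p η μ m (τ ω) s t)‖ ^ 2 :=
          mul_nonneg (by nlinarith) (sq_nonneg _)
        rw [← iterate_succ] at h1
        simp only [Pi.add_apply, Pi.sub_apply]
        linarith
      exact (hsub.add (integrable_const (p.obj xopt))).congr
        (Filter.Eventually.of_forall fun ω => by simp)
  have houter : ∀ s, Integrable (fun ω => p.obj (iterate p η μ m (τ ω) s 0)) P := by
    intro s
    induction s with
    | zero => exact h0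
    | succ s ih => exact hinner s ih m
  exact hinner s (houter s) t

theorem integrable_sq_gradMap (h : IsDraw r P τ) (hp : p.Regular L σ) (hη : 0 < η)
    (hηL : η * L < 1 / 2) (hμ : 0 < μ) (hn : 0 < n) (hb : 0 < b) {xopt : E d}
    (ho : p.IsOptimal xopt) (h0 : Integrable (fun ω => p.obj (τ ω).init) P) (m s t : ℕ) :
    Integrable (fun ω => ‖gradMap p η (iterate p η μ m (τ ω) s t)‖ ^ 2) P := by
  have hγ : 0 < η / 2 - η ^ 2 * L := by nlinarith
  have hobj := h.integrable_obj_iterate hp hη hηL hμ hn hb ho h0 m s t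
  refine ((hobj.sub (integrable_const (p.obj xopt))).const_mul
    (1 / (η / 2 - η ^ 2 * L))).mono' ?_ (Filter.Eventually.of_forall fun ω => ?_)
  · exact (((hp.continuous_gradMap hn hη).measurable.comp
      (h.measurable_iterate hp hη m s t)).norm.pow_const 2).aestronglyMeasurable
  · rw [Real.norm_of_nonneg (sq_nonneg _), one_div, le_inv_mul_iff₀ hγ]
    exact hp.sq_gradMap_le hn hη (by linarith) ho _

theorem avgSqGradMap_le (h : IsDraw r P τ) (hp : p.Regular L σ) (hη : 0 < η)
    (hηL : η * L < 1 / 2) (hμ : 0 < μ) (hn : 0 < n) (hb : 0 < b) {m S : ℕ} (hm : 0 < m)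
    (hS : 0 < S) {xopt : E d} (ho : p.IsOptimal xopt)
    (h0 : Integrable (fun ω => p.obj (τ ω).init) P) {γ : ℝ} (hγ : γ = η / 2 - η ^ 2 * L) :
    avgSqGradMap P p η μ m S τ ≤
      (∫ ω, (p.obj (τ ω).init - p.obj xopt) ∂P) / (((m * S : ℕ) : ℝ) * γ)
        + (1 + 6 * r.delta n b / (b : ℝ)) * ((d : ℝ) + 6) ^ 3 * (L ^ 2 * μ ^ 2 * η / γ)
        + (2 + 12 * r.delta n b / (b : ℝ)) * (2 * (d : ℝ) + 9) * (σ ^ 2 * η / γ) := by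
  have hγ0 : 0 < γ := by rw [hγ]; nlinarith
  have hobj := h.integrable_obj_iterate hp hη hηL hμ hn hb ho h0 m
  have hgrad := h.integrable_sq_gradMap hp hη hηL hμ hn hb ho h0 m
  set C : ℝ := (2 + 12 * r.delta n b / b) * ((d + 6) ^ 3 * (L ^ 2 * μ ^ 2))
        + (4 + 24 * r.delta n b / b) * ((2 * d + 9) * σ ^ 2) with hC
  have hsum := sum_epochs_le (m := m) (S := S) (γ := γ) (c := η / 2 * C) (lo := p.obj xopt)
    (X := fun s t => ∫ ω, p.obj (iterate p η μ m (τ ω) s t) ∂P)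
    (G := fun s t => ∫ ω, ‖gradMap p η (iterate p η μ m (τ ω) s t)‖ ^ 2 ∂P)
    hγ0.le (fun s t => integral_nonneg fun ω => sq_nonneg _)
    (fun s t => by
      obtain ⟨herr, herrC⟩ := h.mixture_error hp hη hμ hn hb m s t
      have h1 := integral_mono ((hobj s (t + 1)).add ((hgrad s t).const_mul γ))
        ((hobj s t).add (herr.const_mul (η / 2))) fun ω => by
          rw [hγ]
          exact hp.obj_prox_add_sq_gradMap_le hn hη (by linarith) (iterate p η μ m (τ ω) s t)
            (mixture p μ (snapshot p η μ m (τ ω) s) ((τ ω).dir s 0) ((τ ω).batch s t)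
              ((τ ω).dir s (t + 1)) (iterate p η μ m (τ ω) s t))
      rw [integral_add' (hobj s (t + 1)) ((hgrad s t).const_mul γ),
        integral_add' (hobj s t) (herr.const_mul (η / 2)), integral_const_mul,
        integral_const_mul] at h1
      have h2 := mul_le_mul_of_nonneg_left herrC (by positivity : 0 ≤ η / 2)
      exact h1.trans (by linarith))
    (fun s => rfl) (fun s => rfl)
    (by
      have h1 := integral_mono ((hgrad S 0).const_mul γ)
        ((hobj S 0).sub (integrable_const (p.obj xopt))) fun ω => by
          simp only [hγ]
          exact hp.sq_gradMap_le hn hη (by linarith) ho _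
      rw [integral_sub' (hobj S 0) (integrable_const _), integral_const_mul] at h1
      simpa using h1)
  have hinit : ∫ ω, (p.obj (τ ω).init - p.obj xopt) ∂P
      = ∫ ω, p.obj (iterate p η μ m (τ ω) 0 0) ∂P - p.obj xopt := by
    rw [integral_sub h0 (integrable_const _)]
    simp [iterate, inner, snapshot]
  rw [avgSqGradMap, hinit]
  have hT : (0 : ℝ) < ((m * S : ℕ) : ℝ) := by exact_mod_cast Nat.mul_pos hm hS
  generalize ((m * S : ℕ) : ℝ) = T at *
  generalize (∑ s ∈ Finset.range S, ∑ t ∈ Finset.Icc 1 m,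
    ∫ ω, ‖gradMap p η (iterate p η μ m (τ ω) s t)‖ ^ 2 ∂P) = A at *
  generalize ∫ ω, p.obj (iterate p η μ m (τ ω) 0 0) ∂P - p.obj xopt = Δ at *
  have e : Δ / (T * γ) + (1 + 6 * r.delta n b / (b : ℝ)) * ((d : ℝ) + 6) ^ 3
      * (L ^ 2 * μ ^ 2 * η / γ) + (2 + 12 * r.delta n b / (b : ℝ)) * (2 * (d : ℝ) + 9)
      * (σ ^ 2 * η / γ) = (Δ + T * (η / 2 * C)) / (T * γ) := by
    rw [hC]
    field_simp
    ring
  rw [e, le_div_iff₀ (by positivity)]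
  calc 1 / T * A * (T * γ) = γ * A := by field_simp
    _ ≤ _ := hsum

end IsDraw

/-! ### Constants for ρ = 1/6 and the final statement -/

/-- Here η/γ = 3. The constants are 7203 = 7·7³·3, from 1 + 6δ/b ≤ 7 and d + 6 ≤ 7d, and 462 =
14·11·3, from 2 + 12δ/b ≤ 14 and 2d + 9 ≤ 11d. -/
theorem rate_bound {d b m S : ℕ} {L C μ σ δ Δ : ℝ} (hL : 0 < L) (hm : 0 < m)
    (hS : 0 < S) (hb : 0 < b) (hδ0 : 0 ≤ δ) (hδ1 : δ ≤ 1) (hμ : 0 < μ)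
    (hμC : μ ≤ C / ((d : ℝ) * √((m * S : ℕ) : ℝ))) {η γ : ℝ} (hη : η = (1 / 6) / L)
    (hγ : γ = η / 2 - η ^ 2 * L) :
    Δ / (((m * S : ℕ) : ℝ) * γ)
        + (1 + 6 * δ / (b : ℝ)) * ((d : ℝ) + 6) ^ 3 * (L ^ 2 * μ ^ 2 * η / γ)
        + (2 + 12 * δ / (b : ℝ)) * (2 * (d : ℝ) + 9) * (σ ^ 2 * η / γ)
      ≤ 18 * L * Δ / ((m * S : ℕ) : ℝ)
        + 7203 * L ^ 2 * C ^ 2 * ((d : ℝ) / ((m * S : ℕ) : ℝ)) + 462 * ((d : ℝ) * σ ^ 2) := by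
  have hT : (0 : ℝ) < ((m * S : ℕ) : ℝ) := by exact_mod_cast Nat.mul_pos hm hS
  generalize ((m * S : ℕ) : ℝ) = T at *
  have hd : (1 : ℝ) ≤ d := by
    -- For d = 0 the upper bound on μ is a division by zero, hence 0, contradicting μ > 0.
    rcases Nat.eq_zero_or_pos d with h | h
    · subst h
      simp at hμC
      linarith
    · exact_mod_cast h
  have hγ' : γ = 1 / (18 * L) := by rw [hγ, hη]; field_simp; norm_num
  have hηγ : η / γ = 3 := by rw [hγ', hη]; field_simp; norm_num
  have hδb : δ / b ≤ 1 := by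
    have : (1 : ℝ) ≤ b := by exact_mod_cast hb
    rw [div_le_one (by linarith)]
    linarith
  have hδb0 : 0 ≤ δ / b := by positivity
  have hμ2 : μ ^ 2 * d ^ 2 * T ≤ C ^ 2 := by
    rw [le_div_iff₀ (by positivity)] at hμC
    have := pow_le_pow_left₀ (by positivity) hμC 2
    rwa [mul_pow, mul_pow, Real.sq_sqrt hT.le, ← mul_assoc] at this
  have e1 : Δ / (T * γ) = 18 * L * Δ / T := by rw [hγ']; field_simp
  have e2 : (1 + 6 * δ / (b : ℝ)) * ((d : ℝ) + 6) ^ 3 * (L ^ 2 * μ ^ 2 * η / γ)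
      ≤ 7203 * L ^ 2 * C ^ 2 * ((d : ℝ) / T) := by
    have h1 : ((d : ℝ) + 6) ^ 3 ≤ (7 * d) ^ 3 := by gcongr; linarith
    have h2 : 1 + 6 * δ / (b : ℝ) ≤ 7 := by rw [mul_div_assoc]; linarith
    have h3 : (1 + 6 * δ / (b : ℝ)) * ((d : ℝ) + 6) ^ 3 ≤ 7 * (7 * d) ^ 3 := by gcongr
    have h4 : L ^ 2 * μ ^ 2 * η / γ = 3 * (L ^ 2 * μ ^ 2) := by rw [mul_div_assoc, hηγ]; ring
    rw [h4, ← mul_div_assoc, le_div_iff₀ hT]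
    calc (1 + 6 * δ / (b : ℝ)) * ((d : ℝ) + 6) ^ 3 * (3 * (L ^ 2 * μ ^ 2)) * T
        ≤ 7 * (7 * d) ^ 3 * (3 * (L ^ 2 * μ ^ 2)) * T := by gcongr
      _ = 7203 * L ^ 2 * d * (μ ^ 2 * d ^ 2 * T) := by ring
      _ ≤ 7203 * L ^ 2 * d * C ^ 2 := by gcongr
      _ = _ := by ring
  have e3 : (2 + 12 * δ / (b : ℝ)) * (2 * (d : ℝ) + 9) * (σ ^ 2 * η / γ)
      ≤ 462 * ((d : ℝ) * σ ^ 2) := by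
    have h1 : 2 * (d : ℝ) + 9 ≤ 11 * d := by linarith
    have h2 : 2 + 12 * δ / (b : ℝ) ≤ 14 := by rw [mul_div_assoc]; linarith
    have h4 : σ ^ 2 * η / γ = 3 * σ ^ 2 := by rw [mul_div_assoc, hηγ]; ring
    rw [h4]
    calc (2 + 12 * δ / (b : ℝ)) * (2 * (d : ℝ) + 9) * (3 * σ ^ 2)
        ≤ 14 * (11 * d) * (3 * σ ^ 2) := by gcongr
      _ = _ := by ring
  rw [e1]
  linarith

end ZOProxSVRG

theorem theorem2 :
    (∀ (d n b m S : ℕ), 0 < n → 0 < b → 0 < m → 0 < S →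
      ∀ (p : ZOProxSVRG.Problem d n) (L σ ρ η μ γ : ℝ), 0 < L → p.Regular L σ →
      0 < ρ → ρ < 1 / 2 → η = ρ / L → 0 < μ → γ = η / 2 - η ^ 2 * L →
      24 * ρ ^ 2 * (m : ℝ) ^ 2 / (b : ℝ) + ρ ≤ 1 →
      ∀ (xopt : ZOProxSVRG.E d), p.IsOptimal xopt →
      ∀ (Ω : Type u) [MeasurableSpace Ω] (P : Measure Ω) [IsProbabilityMeasure P]
        (r : ZOProxSVRG.Sampling) (τ : Ω → ZOProxSVRG.Tape d n b),
      ZOProxSVRG.IsDraw r P τ → Integrable (fun ω => p.obj (τ ω).init) P →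
      (∀ s < S, ∀ t ∈ Finset.Icc 1 m, Integrable
        (fun ω => ‖ZOProxSVRG.gradMap p η (ZOProxSVRG.iterate p η μ m (τ ω) s t)‖ ^ 2) P) ∧
      ZOProxSVRG.avgSqGradMap P p η μ m S τ ≤
        (∫ ω, (p.obj (τ ω).init - p.obj xopt) ∂P) / (((m * S : ℕ) : ℝ) * γ)
        + (1 + 6 * r.delta n b / (b : ℝ)) * ((d : ℝ) + 6) ^ 3 * (L ^ 2 * μ ^ 2 * η / γ)
        + (2 + 12 * r.delta n b / (b : ℝ)) * (2 * (d : ℝ) + 9) * (σ ^ 2 * η / γ)) ∧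
    (∃ K₂ : ℝ, ∀ L C : ℝ, 0 < L → 0 < C → ∃ K₁ : ℝ,
      ∀ (d n b m S : ℕ), 0 < n → 0 < S →
      b = ⌊(n : ℝ) ^ (2 / 3 : ℝ)⌋₊ → m = ⌊(n : ℝ) ^ (1 / 3 : ℝ)⌋₊ →
      ∀ (p : ZOProxSVRG.Problem d n) (σ η μ : ℝ), p.Regular L σ →
      η = (1 / 6) / L → 0 < μ → μ ≤ C / ((d : ℝ) * √((m * S : ℕ) : ℝ)) →
      ∀ (xopt : ZOProxSVRG.E d), p.IsOptimal xopt →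
      ∀ (Ω : Type u) [MeasurableSpace Ω] (P : Measure Ω) [IsProbabilityMeasure P]
        (r : ZOProxSVRG.Sampling) (τ : Ω → ZOProxSVRG.Tape d n b),
      ZOProxSVRG.IsDraw r P τ → Integrable (fun ω => p.obj (τ ω).init) P →
      ZOProxSVRG.avgSqGradMap P p η μ m S τ ≤
        18 * L * (∫ ω, (p.obj (τ ω).init - p.obj xopt) ∂P) / ((m * S : ℕ) : ℝ)
        + K₁ * ((d : ℝ) / ((m * S : ℕ) : ℝ)) + K₂ * ((d : ℝ) * σ ^ 2)) := by
  refine ⟨?_, 462, fun L C hL hC => ⟨7203 * L ^ 2 * C ^ 2, ?_⟩⟩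
  · intro d n b m S hn hb hm hS p L σ ρ η μ γ hL hp hρ hρ2 hη hμ hγ _ xopt ho Ω _ P _ r τ hτ h0
    have hη0 : 0 < η := by rw [hη]; positivity
    have hηL : η * L < 1 / 2 := by rwa [hη, div_mul_cancel₀ _ hL.ne']
    exact ⟨fun s _ t _ => hτ.integrable_sq_gradMap hp hη0 hηL hμ hn hb ho h0 m s t,
      hτ.avgSqGradMap_le hp hη0 hηL hμ hn hb hm hS ho h0 hγ⟩
  · intro d n b m S hn hS hb hm p σ η μ hp hη hμ hμC xopt ho Ω _ P _ r τ hτ h0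
    have hn1 : (1 : ℝ) ≤ n := by exact_mod_cast hn
    have hb0 : 0 < b := by
      rw [hb, Nat.floor_pos]
      exact Real.one_le_rpow hn1 (by norm_num)
    have hm0 : 0 < m := by
      rw [hm, Nat.floor_pos]
      exact Real.one_le_rpow hn1 (by norm_num)
    have hη0 : 0 < η := by rw [hη]; positivity
    have hηL : η * L < 1 / 2 := by rw [hη, div_mul_cancel₀ _ hL.ne']; norm_num
    exact (hτ.avgSqGradMap_le hp hη0 hηL hμ hn hb0 hm0 hS ho h0 rfl).trans
      (ZOProxSVRG.rate_bound hL hm0 hS hb0 r.delta_nonneg r.delta_le_one hμ hμC hη rfl)
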